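/- Let $\mathbb K$ be an algebraically closed field of characteristic zero and let $X$ be an affine algebraic variety over $\mathbb K$ (reduced, not necessarily irreducible) with coordinate ring $\mathcal O(X)$. A $\mathbb K$-derivation $\delta$ of $\mathcal O(X)$ is called locally nilpotent if for every $f\in\mathcal O(X)$ there is $n$ with $\delta^n(f)=0$, and locally finite if every $f\in\mathcal O(X)$ lies in a finite-dimensional $\delta$-stable subspace of $\mathcal O(X)$. Let $\mathcal U(X)\subset\operatorname{Aut}(X)$ be the subgroup generated by all automorphisms $\exp(t\partial)$ with $t\in\mathbb K$ and $\partial$ locally nilpotent, and let $\mathfrak u\subset\operatorname{Der}(\mathcal O(X))$ be the Lie subalgebra generated by all locally nilpotent derivations. A subtorus of $\operatorname{Aut}(X)$ is the image of a faithful regular action of some $\mathbb G_m^r$ ($r\ge 0$) on $X$; let $\mathbb T$ be a subtorus that is maximal with respect to inclusion, and let $\mathfrak t\subset\operatorname{Der}(\mathcal O(X))$ be its Lie algebra, that is, the set of derivations obtained by differentiating the action of $\mathbb T$ on $\mathcal O(X)$ at the identity. **Proposition.** Suppose that $\mathcal U(X)$ is abelian. Then $[\mathfrak t,\mathfrak u]\subset\mathfrak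 u$ and $\mathfrak t\cap\mathfrak u=0$, so that $\mathfrak t+\mathfrak u$ is a semidirect product $\mathfrak t\ltimes\mathfrak u$, and every locally finite derivation of $\mathcal O(X)$ belongs to $\mathfrak t\ltimes\mathfrak u$. -/

import Mathlib

/-!
An affine variety `X` over `K` is given by its coordinate ring `A = O(X)`, a reduced finitely
generated `K`-algebra; vector fields on `X` are the `K`-derivations of `A` (with the commutator
bracket), and the automorphisms of `X` are the `K`-algebra automorphisms of `A` (pulling back
functions is an anti-isomorphism from `Aut(X)` onto `A ≃ₐ[K] A`; it does not affect subgroups,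
commutativity or actions of commutative groups).
-/

namespace AffineAut

section Derivations

variable {K A : Type*} [Field K] [CommRing A] [Algebra K A]

/-- Every element of `A` lies in a finite-dimensional `δ`-stable subspace. -/
def IsLocallyFinite (δ : Derivation K A A) : Prop :=
  ∀ f : A, ∃ V : Submodule K A, FiniteDimensional K V ∧ f ∈ V ∧ ∀ v ∈ V, δ v ∈ V

/-- Every element of `A` is killed by a power of `δ`. -/
def IsLocallyNilpotent (δ : Derivation K A A) : Prop :=
  ∀ f : A, ∃ n : ℕ, (⇑δ)^[n] f = 0

theorem iterate_eq_zero_of_le {δ : Derivation K A A} {f : A} {n m : ℕ} (h : (⇑δ)^[n] f = 0)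
    (hnm : n ≤ m) : (⇑δ)^[m] f = 0 := by
  obtain ⟨k, rfl⟩ := Nat.exists_eq_add_of_le hnm
  rw [Nat.add_comm, Function.iterate_add_apply, h, iterate_map_zero]

/-- The (locally finite) exponential sum `exp(tδ) f = ∑ₙ (tⁿ / n!) δⁿ f`. -/
noncomputable def expSum (δ : Derivation K A A) (t : K) (f : A) : A :=
  ∑ᶠ n : ℕ, (t ^ n * ((n.factorial : K))⁻¹) • (⇑δ)^[n] f

theorem expSum_eq_sum (δ : Derivation K A A) (t : K) {f : A} {N : ℕ} (h : (⇑δ)^[N] f = 0) :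
    expSum δ t f = ∑ n ∈ Finset.range N, (t ^ n * ((n.factorial : K))⁻¹) • (⇑δ)^[n] f := by
  apply finsum_eq_sum_of_support_subset
  intro n hn
  simp only [Finset.coe_range, Set.mem_Iio]
  by_contra hle
  exact hn (by simp [iterate_eq_zero_of_le h (not_lt.mp hle)])

theorem iterate_mul (δ : Derivation K A A) (n : ℕ) (a b : A) :
    (⇑δ)^[n] (a * b) = ∑ ij ∈ Finset.HasAntidiagonal.antidiagonal n,
      n.choose ij.1 • ((⇑δ)^[ij.1] a * (⇑δ)^[ij.2] b) := by
  induction n with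
  | zero => simp
  | succ n ih =>
    rw [Finset.sum_antidiagonal_choose_succ_nsmul
      (M := A) (fun i j => (⇑δ)^[i] a * (⇑δ)^[j] b) n]
    simp only [Function.iterate_succ_apply', ih, map_sum, map_nsmul, Derivation.leibniz,
      smul_add, Finset.sum_add_distrib, smul_eq_mul]
    congr 1
    refine Finset.sum_congr rfl fun ij hij => ?_
    rw [n.choose_symm_of_eq_add (Finset.HasAntidiagonal.mem_antidiagonal.1 hij).symm, mul_comm]

theorem expSum_add {δ : Derivation K A A} (hδ : IsLocallyNilpotent δ) (t : K) (a b : A) :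
    expSum δ t (a + b) = expSum δ t a + expSum δ t b := by
  obtain ⟨n, hn⟩ := hδ a
  obtain ⟨m, hm⟩ := hδ b
  have ha := iterate_eq_zero_of_le hn (le_max_left n m)
  have hb := iterate_eq_zero_of_le hm (le_max_right n m)
  have hab : (⇑δ)^[max n m] (a + b) = 0 := by rw [iterate_map_add, ha, hb, add_zero]
  rw [expSum_eq_sum δ t ha, expSum_eq_sum δ t hb, expSum_eq_sum δ t hab,
    ← Finset.sum_add_distrib]
  exact Finset.sum_congr rfl fun i _ => by rw [iterate_map_add, smul_add]

theorem iterate_smul (δ : Derivation K A A) (n : ℕ) (c : K) (a : A) :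
    (⇑δ)^[n] (c • a) = c • (⇑δ)^[n] a := by
  induction n with
  | zero => rfl
  | succ n ih => rw [Function.iterate_succ_apply', ih, Derivation.map_smul,
      Function.iterate_succ_apply']

theorem expSum_algebraMap (δ : Derivation K A A) (t c : K) :
    expSum δ t (algebraMap K A c) = algebraMap K A c := by
  rw [expSum_eq_sum δ t (N := 1) (by simp)]
  simp

theorem expSum_smul {δ : Derivation K A A} (hδ : IsLocallyNilpotent δ) (t c : K) (a : A) :
    expSum δ t (c • a) = c • expSum δ t a := by
  obtain ⟨n, hn⟩ := hδ a
  have hc : (⇑δ)^[n] (c • a) = 0 := by rw [iterate_smul, hn, smul_zero]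
  rw [expSum_eq_sum δ t hn, expSum_eq_sum δ t hc, Finset.smul_sum]
  exact Finset.sum_congr rfl fun i _ => by rw [iterate_smul, smul_comm]

theorem expSum_zero_left (δ : Derivation K A A) (hδ : IsLocallyNilpotent δ) (a : A) :
    expSum δ 0 a = a := by
  obtain ⟨n, hn⟩ := hδ a
  rw [expSum_eq_sum δ 0 (iterate_eq_zero_of_le hn (Nat.le_succ n)), Finset.sum_range_succ']
  simp

section CharZero

variable [CharZero K]

theorem expSum_mul {δ : Derivation K A A} (hδ : IsLocallyNilpotent δ) (t : K) (a b : A) :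
    expSum δ t (a * b) = expSum δ t a * expSum δ t b := by
  obtain ⟨n, hn⟩ := hδ a
  obtain ⟨m, hm⟩ := hδ b
  obtain ⟨k, hk⟩ := hδ (a * b)
  set N := max (max n m) k
  have ha := iterate_eq_zero_of_le hn (show n ≤ N by simp [N])
  have hb := iterate_eq_zero_of_le hm (show m ≤ N by simp [N])
  have hab := iterate_eq_zero_of_le hk (show k ≤ N + N by simp only [N]; omega)
  let F : A → Polynomial A := fun f => ∑ i ∈ Finset.range (N + N),
    Polynomial.monomial i ((t ^ i * ((i.factorial : K))⁻¹) • (⇑δ)^[i] f)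
  have hcoeff : ∀ f, (⇑δ)^[N + N] f = 0 → ∀ j, (F f).coeff j
      = (t ^ j * ((j.factorial : K))⁻¹) • (⇑δ)^[j] f := by
    intro f hf j
    simp only [F, Polynomial.finsetSum_coeff, Polynomial.coeff_monomial, Finset.sum_ite_eq',
      Finset.mem_range]
    split_ifs with hj
    · rfl
    · rw [iterate_eq_zero_of_le hf (not_lt.mp hj), smul_zero]
  have heval : ∀ f, (⇑δ)^[N + N] f = 0 → expSum δ t f = (F f).eval 1 := by
    intro f hf
    rw [expSum_eq_sum δ t hf]
    simp [F, Polynomial.eval_finsetSum]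
  have ha2 := iterate_eq_zero_of_le ha (Nat.le_add_right N N)
  have hb2 := iterate_eq_zero_of_le hb (Nat.le_add_right N N)
  rw [heval _ hab, heval _ ha2, heval _ hb2, ← Polynomial.eval_mul]
  congr 1
  ext j
  rw [hcoeff _ hab, Polynomial.coeff_mul, iterate_mul, Finset.smul_sum]
  refine Finset.sum_congr rfl fun ij hij => ?_
  rw [hcoeff _ ha2, hcoeff _ hb2, smul_mul_smul_comm, ← Nat.cast_smul_eq_nsmul K, smul_smul]
  congr 1
  rw [← Finset.HasAntidiagonal.mem_antidiagonal.1 hij, Nat.choose_symm_add, Nat.add_choose, Nat.cast_div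
    (Nat.factorial_mul_factorial_dvd_factorial_add _ _)
    (by exact_mod_cast (mul_ne_zero (Nat.factorial_ne_zero _) (Nat.factorial_ne_zero _)))]
  have h1 : ((ij.1 + ij.2).factorial : K) ≠ 0 := by exact_mod_cast Nat.factorial_ne_zero _
  have h2 : (ij.1.factorial : K) ≠ 0 := by exact_mod_cast Nat.factorial_ne_zero _
  have h3 : (ij.2.factorial : K) ≠ 0 := by exact_mod_cast Nat.factorial_ne_zero _
  push_cast
  field_simp
  ring

theorem expSum_expSum {δ : Derivation K A A} (hδ : IsLocallyNilpotent δ) (s t : K) (a : A) :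
    expSum δ s (expSum δ t a) = expSum δ (s + t) a := by
  obtain ⟨N, hN⟩ := hδ a
  let L : A →ₗ[K] A :=
    { toFun := expSum δ s
      map_add' := expSum_add hδ s
      map_smul' := expSum_smul hδ s }
  have hL : ∀ j ∈ Finset.range N,
      L ((t ^ j * ((j.factorial : K))⁻¹) • (⇑δ)^[j] a) =
      ∑ i ∈ Finset.range (N - j), (t ^ j * ((j.factorial : K))⁻¹) •
        (s ^ i * ((i.factorial : K))⁻¹) • (⇑δ)^[j + i] a := by
    intro j hj
    have hj' : (⇑δ)^[N - j] ((⇑δ)^[j] a) = 0 := by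
      rw [← Function.iterate_add_apply, Nat.sub_add_cancel (Finset.mem_range.mp hj).le, hN]
    rw [map_smul, show L ((⇑δ)^[j] a) = expSum δ s ((⇑δ)^[j] a) from rfl,
      expSum_eq_sum δ s hj', Finset.smul_sum]
    refine Finset.sum_congr rfl fun i _ => ?_
    rw [← Function.iterate_add_apply, Nat.add_comm i j]
  change L (expSum δ t a) = _
  rw [expSum_eq_sum δ t hN, map_sum, Finset.sum_congr rfl hL, expSum_eq_sum δ _ hN,
    ← Finset.sum_range_diag_flip N (fun j i => (t ^ j * ((j.factorial : K))⁻¹) •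
        (s ^ i * ((i.factorial : K))⁻¹) • (⇑δ)^[j + i] a)]
  refine Finset.sum_congr rfl fun m _ => ?_
  rw [add_comm s t, add_pow, Finset.sum_mul, Finset.sum_smul]
  refine Finset.sum_congr rfl fun k hk => ?_
  have hkm : k ≤ m := Nat.lt_succ_iff.mp (Finset.mem_range.mp hk)
  rw [Nat.add_sub_cancel' hkm, smul_smul, Nat.cast_choose K hkm]
  have h1 : (m.factorial : K) ≠ 0 := by exact_mod_cast Nat.factorial_ne_zero _
  congr 1
  field_simp

/-- The automorphism `exp(tδ)` for a locally nilpotent derivation `δ`. -/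
noncomputable def expAut (δ : Derivation K A A) (hδ : IsLocallyNilpotent δ) (t : K) :
    A ≃ₐ[K] A where
  toFun := expSum δ t
  invFun := expSum δ (-t)
  left_inv a := by rw [expSum_expSum hδ, neg_add_cancel, expSum_zero_left δ hδ]
  right_inv a := by rw [expSum_expSum hδ, add_neg_cancel, expSum_zero_left δ hδ]
  map_mul' := expSum_mul hδ t
  map_add' := expSum_add hδ t
  commutes' := expSum_algebraMap δ t

variable (K A) in
/-- The group `U(X)` generated by all automorphisms `exp(t∂)`, `t ∈ K`, `∂` locally nilpotent. -/
noncomputable def unipotentGroup : Subgroup (A ≃ₐ[K] A) :=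
  Subgroup.closure {g | ∃ (δ : Derivation K A A) (hδ : IsLocallyNilpotent δ) (t : K),
    g = expAut δ hδ t}

end CharZero

variable (K A) in
/-- The Lie algebra `u(X)` generated by all locally nilpotent derivations. -/
def unipotentLieAlgebra : LieSubalgebra K (Derivation K A A) :=
  LieSubalgebra.lieSpan K (Derivation K A A) {δ | IsLocallyNilpotent δ}

end Derivations

section Torus

variable {K A : Type*} [Field K] [CommRing A] [Algebra K A] {r : ℕ}

/-- The character `t ↦ t^m = ∏ᵢ tᵢ^(mᵢ)` of the torus `(Kˣ)^r`. -/
def torusChar (K : Type*) [Field K] {r : ℕ} (m : Fin r → ℤ) : (Fin r → Kˣ) →* Kˣ where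
  toFun t := ∏ i, t i ^ m i
  map_one' := by simp
  map_mul' s t := by simp [mul_zpow, Finset.prod_mul_distrib]

/-- The value at `t` of the function `∑ₘ cₘ t^m` on the torus, with coefficients in `A`; such
functions are the elements of `A ⊗ O(𝔾ₘ^r) = A ⊗ K[ℤ^r]`. -/
noncomputable def laurentEval (c : (Fin r → ℤ) →₀ A) (t : Fin r → Kˣ) : A :=
  c.sum fun m b => ((torusChar K m t : Kˣ) : K) • b

/-- The derivative at the identity `t = 1`, in the direction of the tangent vector `v ∈ K^r`, of the
function `∑ₘ cₘ t^m`: the derivative of `t^m` is `∑ᵢ mᵢ vᵢ`. -/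
noncomputable def laurentDeriv (c : (Fin r → ℤ) →₀ A) (v : Fin r → K) : A :=
  c.sum fun m b => (∑ i, (m i : K) * v i) • b

variable (K A r) in
/-- A regular action of the torus `𝔾ₘ^r` on `X`: a homomorphism `ρ : (Kˣ)^r → Aut(X)` such that for
every function `f ∈ O(X)` the function `(t, x) ↦ (ρ(t)f)(x)` is regular on `𝔾ₘ^r × X`, that is,
belongs to `O(X) ⊗ O(𝔾ₘ^r)`. -/
structure TorusAction where
  toHom : (Fin r → Kˣ) →* (A ≃ₐ[K] A)
  regular : ∀ f : A, ∃ c : (Fin r → ℤ) →₀ A, ∀ t, toHom t f = laurentEval c t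

/-- A subgroup of `Aut(X)` is a subtorus if it is the image of a faithful regular action of some
torus `𝔾ₘ^r`. -/
def IsSubtorus (T : Subgroup (A ≃ₐ[K] A)) : Prop :=
  ∃ (r : ℕ) (ρ : TorusAction K A r), Function.Injective ρ.toHom ∧ ρ.toHom.range = T

theorem torusChar_injective (K : Type*) [Field K] [CharZero K] (r : ℕ) :
    Function.Injective (torusChar K : (Fin r → ℤ) → ((Fin r → Kˣ) →* Kˣ)) := by
  intro m n h
  ext i
  have h1 := DFunLike.congr_fun h (Pi.mulSingle i (Units.mk0 (2 : K) two_ne_zero))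
  have key : ∀ m : Fin r → ℤ, ((torusChar K m
      (Pi.mulSingle i (Units.mk0 (2 : K) two_ne_zero)) : Kˣ) : K) = ((2 : ℚ) ^ m i : ℚ) := by
    intro m
    simp only [torusChar, MonoidHom.coe_mk, OneHom.coe_mk]
    rw [Finset.prod_eq_single i]
    · simp
    · intro j _ hj
      simp [Pi.mulSingle_eq_of_ne hj]
    · simp
  have h2 : ((2 : ℚ) ^ m i) = (2 : ℚ) ^ n i := by
    have := congrArg (fun u : Kˣ => (u : K)) h1
    simp only [key] at this
    exact_mod_cast this
  exact zpow_right_injective₀ (by norm_num) (by norm_num) h2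

theorem laurentEval_eq_zero [CharZero K] (c : (Fin r → ℤ) →₀ A)
    (h : ∀ t : Fin r → Kˣ, laurentEval c t = 0) : c = 0 := by
  ext m
  rw [Finsupp.coe_zero, Pi.zero_apply, ← Module.forall_dual_apply_eq_zero_iff K]
  intro φ
  have hinj : Function.Injective
      (fun n : Fin r → ℤ => (Units.coeHom K).comp (torusChar K n)) := by
    intro n n' hn
    exact torusChar_injective K r (MonoidHom.ext fun t => Units.ext (DFunLike.congr_fun hn t))
  have hli := (linearIndependent_monoidHom (Fin r → Kˣ) K).comp _ hinj
  have := (linearIndependent_iff.mp hli) (c.mapRange φ (map_zero φ)) ?_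
  · simpa using DFunLike.congr_fun this m
  · rw [Finsupp.linearCombination_apply, Finsupp.sum_mapRange_index (by simp)]
    ext t
    have ht := congrArg φ (h t)
    rw [laurentEval, map_finsuppSum, map_zero] at ht
    rw [Finsupp.sum, Finset.sum_apply, Pi.zero_apply, ← ht, Finsupp.sum]
    refine Finset.sum_congr rfl fun n _ => ?_
    simp [mul_comm]

/-- `δ` is the differential of the action `ρ` in the direction of the tangent vector `v` of `𝔾ₘ^r`
at the identity, i.e. `δ f` is the derivative of `t ↦ ρ(t)f` at `t = 1` along `v`. -/
def TorusAction.IsDifferential (ρ : TorusAction K A r) (v : Fin r → K) (δ : Derivation K A A) :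
    Prop :=
  ∀ (f : A) (c : (Fin r → ℤ) →₀ A), (∀ t, ρ.toHom t f = laurentEval c t) → δ f = laurentDeriv c v

theorem laurentEval_add (c d : (Fin r → ℤ) →₀ A) (t : Fin r → Kˣ) :
    laurentEval (c + d) t = laurentEval c t + laurentEval d t :=
  Finsupp.sum_add_index' (by simp) (by simp [smul_add])

theorem laurentEval_single (m : Fin r → ℤ) (b : A) (t : Fin r → Kˣ) :
    laurentEval (Finsupp.single m b) t = ((torusChar K m t : Kˣ) : K) • b :=
  Finsupp.sum_single_index (by simp)

theorem laurentDeriv_single (m : Fin r → ℤ) (b : A) (v : Fin r → K) :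
    laurentDeriv (Finsupp.single m b) v = (∑ i, (m i : K) * v i) • b :=
  Finsupp.sum_single_index (by simp)

/-- The coefficients of the expansion of `ρ(t)f` are weight vectors. -/
theorem TorusAction.coeff_weight [CharZero K] (ρ : TorusAction K A r) {f : A}
    {c : (Fin r → ℤ) →₀ A} (hc : ∀ t, ρ.toHom t f = laurentEval c t) (m : Fin r → ℤ)
    (s : Fin r → Kˣ) : ρ.toHom s (c m) = ((torusChar K m s : Kˣ) : K) • c m := by
  let L : (Fin r → ℤ) → A →ₗ[K] A := fun n =>
    (ρ.toHom s).toLinearMap - ((torusChar K n s : Kˣ) : K) • LinearMap.id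
  let d : (Fin r → ℤ) →₀ A := Finsupp.onFinset c.support (fun n => L n (c n)) (by
    intro n hn
    rw [Finsupp.mem_support_iff]
    intro h0
    exact hn (by rw [h0, map_zero]))
  have hd : d = 0 := by
    apply laurentEval_eq_zero (K := K)
    intro t
    have h1 : ρ.toHom s (ρ.toHom t f) = ρ.toHom (s * t) f := by rw [map_mul]; rfl
    rw [hc, hc, laurentEval, laurentEval, map_finsuppSum] at h1
    rw [laurentEval, Finsupp.onFinset_sum _ (by simp), ← sub_eq_zero.mpr h1, Finsupp.sum,
      Finsupp.sum, ← Finset.sum_sub_distrib]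
    refine Finset.sum_congr rfl fun n _ => ?_
    simp only [L, LinearMap.sub_apply, LinearMap.smul_apply, LinearMap.id_apply,
      AlgEquiv.toLinearMap_apply, smul_sub, map_smul, map_mul, Units.val_mul, smul_smul]
    rw [mul_comm]
  have := DFunLike.congr_fun hd m
  exact sub_eq_zero.mp this

theorem TorusAction.IsDifferential.apply_weight {ρ : TorusAction K A r} {v : Fin r → K}
    {δ : Derivation K A A} (hδ : ρ.IsDifferential v δ) {m : Fin r → ℤ} {a : A}
    (ha : ∀ t, ρ.toHom t a = ((torusChar K m t : Kˣ) : K) • a) :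
    δ a = (∑ i, (m i : K) * v i) • a := by
  rw [hδ a (Finsupp.single m a) (fun t => by rw [ha, laurentEval_single]), laurentDeriv_single]

/-- The Lie algebra of the torus `𝔾ₘ^r` acting on `X`, realised in the derivations of `O(X)`: the
set of all differentials of the action at the identity. -/
def TorusAction.lieAlgebra [CharZero K] (ρ : TorusAction K A r) :
    LieSubalgebra K (Derivation K A A) where
  carrier := {δ | ∃ v : Fin r → K, ρ.IsDifferential v δ}
  zero_mem' := ⟨0, fun f c _ => by simp [laurentDeriv]⟩
  add_mem' := by
    rintro δ ε ⟨v, hv⟩ ⟨w, hw⟩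
    refine ⟨v + w, fun f c hc => ?_⟩
    rw [Derivation.add_apply, hv f c hc, hw f c hc, laurentDeriv, laurentDeriv, laurentDeriv,
      ← Finsupp.sum_add]
    simp only [Pi.add_apply, mul_add, Finset.sum_add_distrib, add_smul]
  smul_mem' := by
    rintro k δ ⟨v, hv⟩
    refine ⟨k • v, fun f c hc => ?_⟩
    rw [Derivation.smul_apply, hv f c hc, laurentDeriv, laurentDeriv, Finsupp.smul_sum]
    refine Finsupp.sum_congr fun m _ => ?_
    rw [smul_smul, Finset.mul_sum]
    congr 1
    exact Finset.sum_congr rfl fun i _ => by simp only [Pi.smul_apply, smul_eq_mul]; ring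
  lie_mem' := by
    rintro δ ε ⟨v, hv⟩ ⟨w, hw⟩
    refine ⟨0, fun f c hc => ?_⟩
    have h0 : laurentDeriv c (0 : Fin r → K) = 0 := by simp [laurentDeriv]
    rw [h0, Derivation.commutator_apply, hv f c hc, hw f c hc, laurentDeriv, laurentDeriv,
      map_finsuppSum, map_finsuppSum, Finsupp.sum, Finsupp.sum, ← Finset.sum_sub_distrib]
    refine Finset.sum_eq_zero fun m _ => ?_
    rw [Derivation.map_smul, Derivation.map_smul, hv.apply_weight (ρ.coeff_weight hc m),
      hw.apply_weight (ρ.coeff_weight hc m), smul_smul, smul_smul, mul_comm, sub_self]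

end Torus
end AffineAut

/-! Write `T` for the torus. Differentiating `exp(sδ) exp(tε) = exp(tε) exp(sδ)` in both parameters
shows that all locally nilpotent derivations commute when `U(X)` is abelian
(`lie_eq_zero_of_unipotentGroup_comm`). Hence they are closed under addition, and `u` is exactly the
set of locally nilpotent derivations.

Since `A` is finitely generated, a derivation is a finite sum of `T`-weight components, each a
combination of its `T`-conjugates (`TorusAction.exists_derivation_decomposition`). For `ν ∈ u` the
components stay in `u`, and `t` acts on them by scalars, so `[t, u] ⊂ u`. Elements of `t` are
diagonalizable, so a locally nilpotent one vanishes.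

For `δ` locally finite, a nonzero weight component at an exposed point is locally nilpotent
(`TorusAction.isLocallyNilpotent_of_extremal`). Subtracting it preserves local finiteness
(`IsLocallyFinite.add_isLocallyNilpotent`), so induction on the number of components leaves a
derivation commuting with `T`. Its Jordan decomposition (`TorusAction.exists_jordan`) has semisimple
part tangent to a torus `T' ⊇ T`. Maximality forces `T' = T`, so that part lies in `t`, and
everything else is in `u`. -/

namespace AffineAut

/-! ### Commuting locally nilpotent derivations -/

section LocallyNilpotent

variable {K A : Type*} [Field K] [CommRing A] [Algebra K A]

theorem iterate_eq_pow_apply (δ : Derivation K A A) (n : ℕ) (a : A) :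
    (⇑δ)^[n] a = ((δ : A →ₗ[K] A) ^ n : Module.End K A) a := by
  rw [Module.End.pow_apply]
  rfl

theorem IsLocallyNilpotent.zero : IsLocallyNilpotent (0 : Derivation K A A) :=
  fun _ => ⟨1, rfl⟩

theorem IsLocallyNilpotent.smul {δ : Derivation K A A} (hδ : IsLocallyNilpotent δ) (k : K) :
    IsLocallyNilpotent (k • δ) := by
  intro a
  obtain ⟨n, hn⟩ := hδ a
  refine ⟨n, ?_⟩
  rw [iterate_eq_pow_apply] at hn ⊢
  rw [Derivation.coe_smul_linearMap, smul_pow, LinearMap.smul_apply, hn, smul_zero]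

theorem commute_of_lie_eq_zero {δ ε : Derivation K A A} (h : ⁅δ, ε⁆ = 0) :
    Commute (δ : Module.End K A) (ε : Module.End K A) := by
  ext a
  have := DFunLike.congr_fun h a
  rw [Derivation.commutator_apply] at this
  exact sub_eq_zero.mp this

theorem IsLocallyNilpotent.add {δ ε : Derivation K A A} (hδ : IsLocallyNilpotent δ)
    (hε : IsLocallyNilpotent ε) (h : ⁅δ, ε⁆ = 0) : IsLocallyNilpotent (δ + ε) := by
  intro a
  obtain ⟨n, hn⟩ := hδ a
  obtain ⟨m, hm⟩ := hε a
  have hc := commute_of_lie_eq_zero h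
  refine ⟨n + m, ?_⟩
  rw [iterate_eq_pow_apply] at hn hm ⊢
  rw [Derivation.coe_add_linearMap, hc.add_pow, LinearMap.sum_apply]
  refine Finset.sum_eq_zero fun i hi => ?_
  rw [← nsmul_eq_mul', LinearMap.smul_apply]
  suffices ((δ : Module.End K A) ^ i * (ε : Module.End K A) ^ (n + m - i)) a = 0 by
    rw [this, smul_zero]
  rcases le_or_gt n i with hni | hni
  · rw [(hc.pow_pow _ _).eq, ← Nat.sub_add_cancel hni, pow_add, Module.End.mul_apply,
      Module.End.mul_apply, hn, map_zero, map_zero]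
  · rw [show n + m - i = (n - i) + m by omega, pow_add, Module.End.mul_apply,
      Module.End.mul_apply, hm, map_zero, map_zero]

/-- The derivation `g δ g⁻¹`. -/
def conj (g : A ≃ₐ[K] A) (δ : Derivation K A A) : Derivation K A A :=
  Derivation.mk' (g.toLinearMap ∘ₗ (δ : A →ₗ[K] A) ∘ₗ g.symm.toLinearMap) fun a b => by
    simp

theorem conj_apply (g : A ≃ₐ[K] A) (δ : Derivation K A A) (a : A) :
    conj g δ a = g (δ (g.symm a)) := rfl

theorem conj_apply_apply (g : A ≃ₐ[K] A) (δ : Derivation K A A) (a : A) :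
    conj g δ (g a) = g (δ a) := by
  rw [conj_apply, AlgEquiv.symm_apply_apply]

theorem conj_one (δ : Derivation K A A) : conj 1 δ = δ := rfl

theorem conj_mul (g h : A ≃ₐ[K] A) (δ : Derivation K A A) :
    conj (g * h) δ = conj g (conj h δ) := rfl

theorem conj_add (g : A ≃ₐ[K] A) (δ ε : Derivation K A A) :
    conj g (δ + ε) = conj g δ + conj g ε := by
  ext a
  simp [conj_apply]

theorem conj_smul (g : A ≃ₐ[K] A) (k : K) (δ : Derivation K A A) :
    conj g (k • δ) = k • conj g δ := by
  ext a
  simp [conj_apply]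

theorem conj_sum {ι : Type*} (g : A ≃ₐ[K] A) (s : Finset ι) (δ : ι → Derivation K A A) :
    conj g (∑ i ∈ s, δ i) = ∑ i ∈ s, conj g (δ i) :=
  map_sum (AddMonoidHom.mk' (conj g) (conj_add g)) δ s

theorem conj_iterate (g : A ≃ₐ[K] A) (δ : Derivation K A A) (n : ℕ) (a : A) :
    (⇑(conj g δ))^[n] a = g ((⇑δ)^[n] (g.symm a)) := by
  induction n with
  | zero => simp
  | succ n ih => rw [Function.iterate_succ_apply', ih, conj_apply_apply,
      Function.iterate_succ_apply']

theorem IsLocallyNilpotent.conj {δ : Derivation K A A} (hδ : IsLocallyNilpotent δ)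
    (g : A ≃ₐ[K] A) : IsLocallyNilpotent (conj g δ) := by
  intro a
  obtain ⟨n, hn⟩ := hδ (g.symm a)
  exact ⟨n, by rw [conj_iterate, hn, map_zero]⟩

theorem eq_zero_of_forall_sum_pow_smul_eq_zero [Infinite K] {N : ℕ} {b : ℕ → A}
    (h : ∀ s : K, ∑ n ∈ Finset.range N, s ^ n • b n = 0) {n : ℕ} (hn : n < N) : b n = 0 := by
  rw [← Module.forall_dual_apply_eq_zero_iff K]
  intro φ
  let p : Polynomial K := ∑ i ∈ Finset.range N, Polynomial.monomial i (φ (b i))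
  have hp : p = 0 := by
    apply Polynomial.funext
    intro s
    have := congrArg φ (h s)
    simp only [map_sum, map_smul, smul_eq_mul, map_zero] at this
    simp only [p, Polynomial.eval_finsetSum, Polynomial.eval_monomial, Polynomial.eval_zero]
    rw [← this]
    exact Finset.sum_congr rfl fun _ _ => mul_comm _ _
  have := congrArg (fun q => q.coeff n) hp
  simpa [p, Polynomial.finsetSum_coeff, Polynomial.coeff_monomial, hn] using this

variable [CharZero K]

/-- A linear map commuting with the one-parameter group `exp(tδ)` commutes with `δ`. -/
theorem comm_of_comm_expSum {δ : Derivation K A A} (hδ : IsLocallyNilpotent δ) (L : A →ₗ[K] A)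
    (h : ∀ (t : K) (a : A), L (expSum δ t a) = expSum δ t (L a)) (a : A) : L (δ a) = δ (L a) := by
  obtain ⟨n, hn⟩ := hδ a
  obtain ⟨m, hm⟩ := hδ (L a)
  -- The extra 2 keeps the linear coefficient, index 1, inside the range even when `n = m = 0`.
  have ha := iterate_eq_zero_of_le hn (show n ≤ n + m + 2 by omega)
  have hb := iterate_eq_zero_of_le hm (show m ≤ n + m + 2 by omega)
  have key := eq_zero_of_forall_sum_pow_smul_eq_zero (K := K) (N := n + m + 2)
    (b := fun i => ((i.factorial : K))⁻¹ • (L ((⇑δ)^[i] a) - (⇑δ)^[i] (L a))) (fun s => by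
      have := h s a
      rw [expSum_eq_sum δ s ha, expSum_eq_sum δ s hb, map_sum, ← sub_eq_zero,
        ← Finset.sum_sub_distrib] at this
      rw [← this]
      refine Finset.sum_congr rfl fun i _ => ?_
      rw [map_smul, ← smul_sub, smul_smul]) (n := 1) (by omega)
  simpa [sub_eq_zero] using key

/-- Two passages from a one-parameter group to its generator: first in `s` with `exp(tε)` fixed,
then in `t` with `δ` fixed. -/
theorem lie_eq_zero_of_unipotentGroup_comm
    (hU : ∀ g ∈ unipotentGroup K A, ∀ h ∈ unipotentGroup K A, g * h = h * g)
    {δ ε : Derivation K A A} (hδ : IsLocallyNilpotent δ) (hε : IsLocallyNilpotent ε) :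
    ⁅δ, ε⁆ = 0 := by
  have h1 : ∀ s t a, expSum δ s (expSum ε t a) = expSum ε t (expSum δ s a) := fun s t a =>
    DFunLike.congr_fun (hU (expAut δ hδ s) (Subgroup.subset_closure ⟨δ, hδ, s, rfl⟩)
      (expAut ε hε t) (Subgroup.subset_closure ⟨ε, hε, t, rfl⟩)) a
  have h2 : ∀ t a, expSum ε t (δ a) = δ (expSum ε t a) := fun t a =>
    comm_of_comm_expSum hδ (expAut ε hε t).toLinearMap (fun s b => (h1 s t b).symm) a
  ext a
  rw [Derivation.commutator_apply, Derivation.zero_apply, sub_eq_zero]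
  exact comm_of_comm_expSum hε (δ : A →ₗ[K] A) (fun t b => (h2 t b).symm) a

/-- All brackets vanish, so sums of locally nilpotent derivations are locally nilpotent and the
generators already form a Lie algebra. -/
theorem mem_unipotentLieAlgebra_iff
    (hU : ∀ g ∈ unipotentGroup K A, ∀ h ∈ unipotentGroup K A, g * h = h * g)
    {δ : Derivation K A A} : δ ∈ unipotentLieAlgebra K A ↔ IsLocallyNilpotent δ := by
  refine ⟨fun h => ?_, fun h => LieSubalgebra.subset_lieSpan h⟩
  let L : LieSubalgebra K (Derivation K A A) :=
    { carrier := {δ | IsLocallyNilpotent δ}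
      zero_mem' := IsLocallyNilpotent.zero
      add_mem' := fun h1 h2 => h1.add h2 (lie_eq_zero_of_unipotentGroup_comm hU h1 h2)
      smul_mem' := fun k _ h => h.smul k
      lie_mem' := fun {x y} h1 h2 => by
        rw [lie_eq_zero_of_unipotentGroup_comm hU h1 h2]
        exact IsLocallyNilpotent.zero }
  exact (LieSubalgebra.lieSpan_le (K := L)).mpr (fun _ h => h) h

end LocallyNilpotent

/-! ### Weight spaces of a torus action -/

section TorusWeights

variable {K A : Type*} [Field K] [CommRing A] [Algebra K A] {r : ℕ}

theorem torusChar_add (m n : Fin r → ℤ) (t : Fin r → Kˣ) :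
    torusChar K (m + n) t = torusChar K m t * torusChar K n t := by
  simp [torusChar, zpow_add, Finset.prod_mul_distrib]

theorem torusChar_zero (t : Fin r → Kˣ) : torusChar K (0 : Fin r → ℤ) t = 1 := by
  simp [torusChar]

theorem torusChar_neg (m : Fin r → ℤ) (t : Fin r → Kˣ) :
    torusChar K (-m) t = (torusChar K m t)⁻¹ := by
  simp [torusChar]

theorem torusChar_single (i : Fin r) (t : Fin r → Kˣ) :
    torusChar K (Pi.single i 1) t = t i := by
  simp only [torusChar, MonoidHom.coe_mk, OneHom.coe_mk]
  rw [Finset.prod_eq_single i (fun j _ hj => by simp [hj]) (by simp)]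
  simp

theorem torusChar_zsmul (k : ℤ) (m : Fin r → ℤ) (t : Fin r → Kˣ) :
    torusChar K (k • m) t = torusChar K m t ^ k := by
  simp only [torusChar, MonoidHom.coe_mk, OneHom.coe_mk, Pi.smul_apply, smul_eq_mul,
    ← Finset.prod_zpow, ← zpow_mul, mul_comm]

theorem torusChar_sum {ι : Type*} (s : Finset ι) (m : ι → Fin r → ℤ) (t : Fin r → Kˣ) :
    torusChar K (∑ i ∈ s, m i) t = ∏ i ∈ s, torusChar K (m i) t := by
  classical
  induction s using Finset.induction_on with
  | empty => exact torusChar_zero t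
  | insert i s hi ih => rw [Finset.sum_insert hi, Finset.prod_insert hi, torusChar_add, ih]

theorem laurentEval_smul (k : K) (c : (Fin r → ℤ) →₀ A) (t : Fin r → Kˣ) :
    laurentEval (c.mapRange (k • ·) (smul_zero k)) t = k • laurentEval c t := by
  rw [laurentEval, Finsupp.sum_mapRange_index (by simp), laurentEval, Finsupp.smul_sum]
  exact Finsupp.sum_congr fun m _ => smul_comm _ _ _

/-- Functions on the torus with values in `A` which are regular. -/
def regularFunctions (K A : Type*) [Field K] [CommRing A] [Algebra K A] (r : ℕ) :
    Submodule K ((Fin r → Kˣ) → A) where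
  carrier := {F | ∃ c : (Fin r → ℤ) →₀ A, ∀ t, F t = laurentEval c t}
  zero_mem' := ⟨0, fun t => by simp [laurentEval]⟩
  add_mem' := by
    rintro F G ⟨c, hc⟩ ⟨d, hd⟩
    exact ⟨c + d, fun t => by rw [laurentEval_add, ← hc, ← hd, Pi.add_apply]⟩
  smul_mem' := by
    rintro k F ⟨c, hc⟩
    exact ⟨c.mapRange (k • ·) (smul_zero k), fun t => by
      rw [laurentEval_smul, ← hc, Pi.smul_apply]⟩

theorem torusChar_smul_mem_regularFunctions (m : Fin r → ℤ) (b : A) :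
    (fun t => ((torusChar K m t : Kˣ) : K) • b) ∈ regularFunctions K A r :=
  ⟨Finsupp.single m b, fun t => by rw [laurentEval_single]⟩

/-- The functions `a` with `ρ(t) a = t^m a`. -/
def TorusAction.weightSpace (ρ : TorusAction K A r) (m : Fin r → ℤ) : Submodule K A where
  carrier := {a | ∀ t, ρ.toHom t a = ((torusChar K m t : Kˣ) : K) • a}
  zero_mem' := fun t => by simp
  add_mem' := fun ha hb t => by rw [map_add, ha t, hb t, smul_add]
  smul_mem' := fun k a ha t => by rw [map_smul, ha t, smul_comm]

theorem TorusAction.mul_mem_weightSpace {ρ : TorusAction K A r} {m n : Fin r → ℤ} {a b : A}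
    (ha : a ∈ ρ.weightSpace m) (hb : b ∈ ρ.weightSpace n) : a * b ∈ ρ.weightSpace (m + n) := by
  intro t
  rw [map_mul, ha t, hb t, smul_mul_smul_comm, torusChar_add, Units.val_mul]

theorem TorusAction.one_mem_weightSpace (ρ : TorusAction K A r) :
    (1 : A) ∈ ρ.weightSpace 0 := fun t => by simp [torusChar_zero]

theorem sum_derivation_apply {ι : Type*} (s : Finset ι) (δ : ι → Derivation K A A) (a : A) :
    (∑ i ∈ s, δ i) a = ∑ i ∈ s, δ i a := by
  rw [← Derivation.coeFnAddMonoidHom_apply, map_sum, Finset.sum_apply]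
  rfl

theorem TorusAction.conj_eq_self_iff {ρ : TorusAction K A r} {δ : Derivation K A A} :
    (∀ t, conj (ρ.toHom t) δ = δ) ↔ ∀ t a, ρ.toHom t (δ a) = δ (ρ.toHom t a) := by
  refine ⟨fun h t a => ?_, fun h t => ?_⟩
  · rw [← conj_apply_apply, h t]
  · ext a
    rw [conj_apply, h, AlgEquiv.apply_symm_apply]

/-- A weight derivation of weight `m` shifts weight spaces by `m`. -/
theorem TorusAction.apply_mem_weightSpace {ρ : TorusAction K A r} {δ : Derivation K A A}
    {m n : Fin r → ℤ} (hδ : ∀ t, conj (ρ.toHom t) δ = ((torusChar K m t : Kˣ) : K) • δ) {a : A}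
    (ha : a ∈ ρ.weightSpace n) : δ a ∈ ρ.weightSpace (m + n) := by
  intro t
  rw [← conj_apply_apply, hδ t, ha t, Derivation.smul_apply, Derivation.map_smul, smul_smul,
    torusChar_add, Units.val_mul]

theorem derivation_ext_of_iSup_eq_top {ι : Type*} {V : ι → Submodule K A} (hV : ⨆ i, V i = ⊤)
    {δ ε : Derivation K A A} (h : ∀ i, ∀ a ∈ V i, δ a = ε a) : δ = ε := by
  ext a
  have ha : a ∈ ⨆ i, V i := by rw [hV]; trivial
  induction ha using Submodule.iSup_induction' with
  | mem i a ha => exact h i a ha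
  | zero => simp
  | add x y _ _ hx hy => simp [hx, hy]

variable [CharZero K]

theorem TorusAction.iSup_weightSpace (ρ : TorusAction K A r) : ⨆ m, ρ.weightSpace m = ⊤ := by
  rw [eq_top_iff]
  intro f _
  obtain ⟨c, hc⟩ := ρ.regular f
  have h1 : f = laurentEval c (1 : Fin r → Kˣ) := by rw [← hc, map_one]; rfl
  rw [h1, laurentEval]
  refine Submodule.sum_mem _ fun m _ => Submodule.smul_mem _ _ ?_
  exact Submodule.mem_iSup_of_mem m fun s => ρ.coeff_weight hc m s

/-- Joint eigenspaces of a torus action and generalized eigenspaces of a commuting operator are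
independent. -/
theorem TorusAction.iSupIndep_weightSpace_inf_maxGenEigenspace (ρ : TorusAction K A r)
    (D : Module.End K A) (hD : ∀ t a, ρ.toHom t (D a) = D (ρ.toHom t a)) :
    iSupIndep fun w : (Fin r → ℤ) × K => ρ.weightSpace w.1 ⊓ D.maxGenEigenspace w.2 := by
  -- `none` stands for `D` and `some t` for `ρ(t)`, so independence for one commuting family of
  -- operators applies.
  let f : Option (Fin r → Kˣ) → Module.End K A := fun o =>
    o.elim D fun t => (ρ.toHom t).toLinearMap
  have hcomm : ∀ i j, Commute (f i) (f j) := by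
    rintro (_ | s) (_ | t)
    · exact Commute.refl _
    · exact LinearMap.ext fun a => (hD t a).symm
    · exact LinearMap.ext fun a => hD s a
    · refine LinearMap.ext fun a => ?_
      change (ρ.toHom s * ρ.toHom t) a = (ρ.toHom t * ρ.toHom s) a
      rw [← map_mul, ← map_mul, mul_comm]
  have h := Module.End.independent_iInf_maxGenEigenspace_of_forall_mapsTo f
    fun i j φ => Module.End.mapsTo_maxGenEigenspace_of_comm (hcomm j i) φ
  let χ : (Fin r → ℤ) × K → Option (Fin r → Kˣ) → K := fun w o =>
    o.elim w.2 fun t => ((torusChar K w.1 t : Kˣ) : K)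
  have hχ : Function.Injective χ := by
    rintro ⟨m, k⟩ ⟨n, l⟩ he
    have h1 : k = l := congrFun he none
    have h2 : m = n := torusChar_injective K r
      (MonoidHom.ext fun t => Units.ext (congrFun he (some t)))
    rw [h1, h2]
  refine (h.comp hχ).mono fun w => le_iInf ?_
  rintro (_ | t)
  · exact inf_le_right
  · exact inf_le_left.trans fun a ha => Module.End.eigenspace_le_maxGenEigenspace
      (Module.End.mem_eigenspace_iff.mpr (ha t))

theorem TorusAction.iSupIndep_weightSpace (ρ : TorusAction K A r) : iSupIndep ρ.weightSpace := by
  refine ((ρ.iSupIndep_weightSpace_inf_maxGenEigenspace 0 (by simp)).comp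
    (Prod.mk_left_injective (0 : K))).mono fun m => le_inf le_rfl fun a _ => ?_
  exact Module.End.eigenspace_le_maxGenEigenspace (Module.End.mem_eigenspace_iff.mpr (by simp))

/-- A linear combination of the values of characters which singles out prescribed coefficients. -/
theorem exists_dual_torusChar (F : Finset (Fin r → ℤ)) (b : (Fin r → ℤ) → K) :
    ∃ k : (Fin r → Kˣ) →₀ K, ∀ m ∈ F, k.sum (fun t x => x * ((torusChar K m t : Kˣ) : K)) = b m := by
  let Φ : ((Fin r → Kˣ) →₀ K) →ₗ[K] (F → K) :=
    Finsupp.lsum K fun t => LinearMap.toSpanSingleton K (F → K)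
      (fun m => ((torusChar K m.1 t : Kˣ) : K))
  have hΦ : ∀ k (m : F), Φ k m = k.sum (fun t x => x * ((torusChar K m.1 t : Kˣ) : K)) := by
    intro k m
    simp [Φ, Finsupp.sum, Finset.sum_apply]
  suffices LinearMap.range Φ = ⊤ by
    obtain ⟨k, hk⟩ := LinearMap.range_eq_top.mp this (fun m => b m.1)
    exact ⟨k, fun m hm => by rw [← hΦ k ⟨m, hm⟩, hk]⟩
  -- A nonzero functional vanishing on the range would be a nontrivial linear relation among the
  -- distinct characters in `F`.
  by_contra hne
  obtain ⟨φ, hφ0, hφ⟩ := Submodule.exists_le_ker_of_lt_top _ (lt_top_iff_ne_top.mpr hne)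
  apply hφ0
  classical
  let c : (Fin r → ℤ) →₀ K := Finsupp.onFinset F
    (fun m => if h : m ∈ F then φ (Pi.single ⟨m, h⟩ 1) else 0) (fun m hm => by
      by_contra h
      simp [h] at hm)
  have hc : c = 0 := by
    apply laurentEval_eq_zero (K := K)
    intro t
    have h1 : φ (Φ (Finsupp.single t 1)) = 0 := hφ ⟨_, rfl⟩
    rw [laurentEval, Finsupp.onFinset_sum _ (by simp), ← h1,
      LinearMap.pi_apply_eq_sum_univ φ (Φ (Finsupp.single t 1)), ← Finset.sum_attach]
    refine Finset.sum_congr rfl fun m _ => ?_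
    have h2 : Φ (Finsupp.single t 1) m = ((torusChar K m.1 t : Kˣ) : K) := by
      rw [hΦ, Finsupp.sum_single_index (by simp), one_mul]
    rw [h2, dif_pos m.2]
    congr 2
    ext n
    simp [Pi.single_apply, eq_comm]
  refine LinearMap.pi_ext' fun m => LinearMap.ext_ring ?_
  have := DFunLike.congr_fun hc m.1
  simpa [c] using this

end TorusWeights

/-! ### Weight components of derivations -/

section Conjugation

variable {K A : Type*} [Field K] [CharZero K] [CommRing A] [Algebra K A] {r : ℕ}

/-- On `a` of weight `m` the value is `t^(-m) ρ(t)(δ a)`, and `ρ(t)(δ a)` is regular in `t`. -/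
theorem TorusAction.conj_apply_mem_regularFunctions (ρ : TorusAction K A r) (δ : Derivation K A A)
    (a : A) : (fun t => conj (ρ.toHom t) δ a) ∈ regularFunctions K A r := by
  have ha : a ∈ ⨆ m, ρ.weightSpace m := by rw [ρ.iSup_weightSpace]; trivial
  have hb : ∀ (n : Fin r → ℤ) (b : A),
      (fun t => ((torusChar K n t : Kˣ) : K) • ρ.toHom t b) ∈ regularFunctions K A r := by
    intro n b
    have hb : b ∈ ⨆ m, ρ.weightSpace m := by rw [ρ.iSup_weightSpace]; trivial
    induction hb using Submodule.iSup_induction' with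
    | mem m b hb =>
      convert torusChar_smul_mem_regularFunctions (n + m) b using 2 with t
      rw [hb t, smul_smul, torusChar_add, Units.val_mul]
    | zero =>
      simp only [map_zero, smul_zero]
      exact (regularFunctions K A r).zero_mem
    | add x y _ _ hx hy => simpa [Pi.add_def] using Submodule.add_mem _ hx hy
  induction ha using Submodule.iSup_induction' with
  | mem m a ha =>
    convert hb (-m) (δ a) using 2 with t
    have h1 : (ρ.toHom t).symm a = ((torusChar K (-m) t : Kˣ) : K) • a := by
      rw [AlgEquiv.symm_apply_eq, map_smul, ha t, smul_smul, torusChar_neg]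
      simp
    rw [conj_apply, h1, Derivation.map_smul, map_smul]
  | zero =>
    simp only [map_zero]
    exact (regularFunctions K A r).zero_mem
  | add x y _ _ hx hy => simpa [Pi.add_def] using Submodule.add_mem _ hx hy

/-- Derivations of a finitely generated algebra decompose into weight components with respect to
a torus action, and each component is a linear combination of conjugates. -/
theorem TorusAction.exists_derivation_decomposition [Algebra.FiniteType K A]
    (ρ : TorusAction K A r) (δ : Derivation K A A) :
    ∃ c : (Fin r → ℤ) →₀ Derivation K A A,
      (∀ m, c m ∈ Submodule.span K (Set.range fun t => conj (ρ.toHom t) δ)) ∧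
      (∀ m t, conj (ρ.toHom t) (c m) = ((torusChar K m t : Kˣ) : K) • c m) ∧
      δ = c.sum fun _ ε => ε := by
  classical
  obtain ⟨S, hS⟩ := (Algebra.FiniteType.out : (⊤ : Subalgebra K A).FG)
  choose e he using fun a => ρ.conj_apply_mem_regularFunctions δ a
  -- A derivation is determined on the finite generating set `S`, so only the finitely many weights
  -- in `F` matter.
  let F : Finset (Fin r → ℤ) := S.biUnion fun a => (e a).support
  have heF : ∀ a ∈ S, ∀ t, conj (ρ.toHom t) δ a =
      ∑ m ∈ F, ((torusChar K m t : Kˣ) : K) • e a m := by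
    intro a ha t
    have h0 : conj (ρ.toHom t) δ a = laurentEval (e a) t := he a t
    rw [h0, laurentEval]
    exact Finsupp.sum_of_support_subset _ (Finset.subset_biUnion_of_mem (fun a => (e a).support) ha)
      _ (by simp)
  have hext : ∀ D E : Derivation K A A, (∀ a ∈ S, D a = E a) → D = E := by
    intro D E h
    ext a
    exact Derivation.eqOn_adjoin (s := (S : Set A)) h (by rw [hS]; trivial)
  -- For `m` in `F`, averaging the conjugates of `δ` against `k m` extracts the coefficient of
  -- `t^m`, and the result is visibly a derivation.
  choose k hk using fun m : Fin r → ℤ => exists_dual_torusChar (K := K) F (Pi.single m 1)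
  let C : (Fin r → ℤ) → Derivation K A A := fun m =>
    ∑ t ∈ (k m).support, k m t • conj (ρ.toHom t) δ
  have hCapply : ∀ m ∈ F, ∀ a ∈ S, C m a = e a m := by
    intro m hm a ha
    have : C m a = ∑ t ∈ (k m).support, k m t • conj (ρ.toHom t) δ a := by
      rw [sum_derivation_apply]
      rfl
    rw [this]
    calc _ = ∑ t ∈ (k m).support, ∑ n ∈ F, (k m t * ((torusChar K n t : Kˣ) : K)) • e a n := by
          refine Finset.sum_congr rfl fun t _ => ?_
          rw [heF a ha t, Finset.smul_sum]
          simp only [smul_smul]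
      _ = ∑ n ∈ F, (Pi.single m 1 : (Fin r → ℤ) → K) n • e a n := by
          rw [Finset.sum_comm]
          refine Finset.sum_congr rfl fun n hn => ?_
          rw [← Finset.sum_smul, ← hk m n hn, Finsupp.sum]
      _ = e a m := by
          rw [Finset.sum_eq_single m (fun n _ hn => by simp [hn]) (fun h => absurd hm h)]
          simp
  have hconj : ∀ t, conj (ρ.toHom t) δ = ∑ m ∈ F, ((torusChar K m t : Kˣ) : K) • C m := by
    intro t
    apply hext
    intro a ha
    rw [heF a ha t, sum_derivation_apply]
    exact Finset.sum_congr rfl fun m hm => by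
      rw [← hCapply m hm a ha]; rfl
  -- Conjugation by `s` replaces `t` by `st`; expanding and extracting again leaves only the factor
  -- `s^m`.
  have hCw : ∀ m ∈ F, ∀ s, conj (ρ.toHom s) (C m) = ((torusChar K m s : Kˣ) : K) • C m := by
    intro m hm s
    calc conj (ρ.toHom s) (C m)
        = ∑ t ∈ (k m).support, ∑ n ∈ F, (k m t * ((torusChar K n t : Kˣ) : K)) •
            ((torusChar K n s : Kˣ) : K) • C n := by
          rw [conj_sum]
          refine Finset.sum_congr rfl fun t _ => ?_
          rw [conj_smul, ← conj_mul, ← map_mul, hconj, Finset.smul_sum]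
          refine Finset.sum_congr rfl fun n _ => ?_
          rw [smul_smul, smul_smul, map_mul, Units.val_mul]
          ring_nf
      _ = ∑ n ∈ F, (Pi.single m 1 : (Fin r → ℤ) → K) n • ((torusChar K n s : Kˣ) : K) • C n := by
          rw [Finset.sum_comm]
          refine Finset.sum_congr rfl fun n hn => ?_
          rw [← Finset.sum_smul, ← hk m n hn, Finsupp.sum]
      _ = ((torusChar K m s : Kˣ) : K) • C m := by
          rw [Finset.sum_eq_single m (fun n _ hn => by simp [hn]) (fun h => absurd hm h)]
          simp
  refine ⟨Finsupp.onFinset F (fun m => if m ∈ F then C m else 0) (fun m hm => by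
      by_contra h
      simp [h] at hm), fun m => ?_, fun m t => ?_, ?_⟩
  · rw [Finsupp.onFinset_apply]
    split_ifs
    · exact Submodule.sum_mem _ fun t _ => Submodule.smul_mem _ _ (Submodule.subset_span ⟨t, rfl⟩)
    · exact Submodule.zero_mem _
  · rw [Finsupp.onFinset_apply]
    split_ifs with h
    · exact hCw m h t
    · rw [smul_zero]
      ext a
      simp [conj_apply]
  · rw [Finsupp.onFinset_sum _ (fun _ => rfl)]
    conv_lhs => rw [← conj_one δ, ← map_one ρ.toHom, hconj]
    refine Finset.sum_congr rfl fun m hm => ?_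
    rw [if_pos hm, map_one, Units.val_one, one_smul]

/-- `τ` is the scalar `⟨n, v⟩` on weight `n`, and `δ` raises weights by `m`; the two scalars differ
by `⟨m, v⟩`. -/
theorem TorusAction.IsDifferential.lie_eq_smul {ρ : TorusAction K A r} {τ δ : Derivation K A A}
    {v : Fin r → K} (hτ : ρ.IsDifferential v τ) {m : Fin r → ℤ}
    (hδ : ∀ t, conj (ρ.toHom t) δ = ((torusChar K m t : Kˣ) : K) • δ) :
    ⁅τ, δ⁆ = (∑ i, (m i : K) * v i) • δ := by
  refine derivation_ext_of_iSup_eq_top ρ.iSup_weightSpace fun n a ha => ?_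
  rw [Derivation.commutator_apply, hτ.apply_weight (TorusAction.apply_mem_weightSpace hδ ha),
    hτ.apply_weight ha, Derivation.map_smul, ← sub_smul, Derivation.smul_apply]
  congr 1
  simp [add_mul, Finset.sum_add_distrib]

/-- If all locally nilpotent derivations commute, the weight components of a locally nilpotent
derivation are locally nilpotent. -/
theorem TorusAction.isLocallyNilpotent_of_mem_span_conj
    (hU : ∀ g ∈ unipotentGroup K A, ∀ h ∈ unipotentGroup K A, g * h = h * g)
    (ρ : TorusAction K A r) {ν ε : Derivation K A A} (hν : IsLocallyNilpotent ν)
    (hε : ε ∈ Submodule.span K (Set.range fun t => conj (ρ.toHom t) ν)) :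
    IsLocallyNilpotent ε := by
  rw [← mem_unipotentLieAlgebra_iff hU]
  refine (Submodule.span_le (p := (unipotentLieAlgebra K A).toSubmodule)).mpr ?_ hε
  rintro _ ⟨t, rfl⟩
  exact (mem_unipotentLieAlgebra_iff hU).mpr (hν.conj _)

theorem TorusAction.lie_mem_unipotentLieAlgebra [Algebra.FiniteType K A]
    (hU : ∀ g ∈ unipotentGroup K A, ∀ h ∈ unipotentGroup K A, g * h = h * g)
    (ρ : TorusAction K A r) {τ ν : Derivation K A A} (hτ : τ ∈ ρ.lieAlgebra)
    (hν : ν ∈ unipotentLieAlgebra K A) : ⁅τ, ν⁆ ∈ unipotentLieAlgebra K A := by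
  obtain ⟨v, hv⟩ := hτ
  obtain ⟨c, hc, hcw, hsum⟩ := ρ.exists_derivation_decomposition ν
  rw [hsum, Finsupp.sum, lie_sum]
  refine sum_mem fun m _ => ?_
  rw [hv.lie_eq_smul (hcw m)]
  refine (unipotentLieAlgebra K A).smul_mem _ ((mem_unipotentLieAlgebra_iff hU).mpr ?_)
  exact ρ.isLocallyNilpotent_of_mem_span_conj hU ((mem_unipotentLieAlgebra_iff hU).mp hν) (hc m)

theorem TorusAction.eq_zero_of_mem_lieAlgebra_of_isLocallyNilpotent (ρ : TorusAction K A r)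
    {δ : Derivation K A A} (hδ : δ ∈ ρ.lieAlgebra) (hn : IsLocallyNilpotent δ) : δ = 0 := by
  obtain ⟨v, hv⟩ := hδ
  refine derivation_ext_of_iSup_eq_top ρ.iSup_weightSpace fun m a ha => ?_
  have h1 := hv.apply_weight ha
  have h2 : ∀ n : ℕ, (⇑δ)^[n] a = (∑ i, (m i : K) * v i) ^ n • a := by
    intro n
    induction n with
    | zero => simp
    | succ n ih => rw [Function.iterate_succ_apply', ih, Derivation.map_smul, h1, smul_smul, pow_succ]
  obtain ⟨n, hn⟩ := hn a
  rw [h2] at hn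
  rw [h1, Derivation.zero_apply]
  rcases smul_eq_zero.mp hn with h | h
  · rw [eq_zero_of_pow_eq_zero h, zero_smul]
  · rw [h, smul_zero]

end Conjugation

/-! ### Gradings and operators acting by scalars on the pieces -/

section Grading

variable {K A G : Type*} [Field K] [CommRing A] [Algebra K A] {V : G → Submodule K A}

theorem exists_linearMap_smul_of_iSupIndep (hi : iSupIndep V) (hs : ⨆ g, V g = ⊤) (f : G → K) :
    ∃ L : A →ₗ[K] A, ∀ g, ∀ a ∈ V g, L a = f g • a := by
  classical
  have hI := DirectSum.isInternal_submodule_of_iSupIndep_of_iSup_eq_top hi hs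
  let E := LinearEquiv.ofBijective (DirectSum.coeLinearMap V) hI
  refine ⟨DirectSum.toModule K G A (fun g => f g • (V g).subtype) ∘ₗ E.symm.toLinearMap,
    fun g a ha => ?_⟩
  have h1 : E.symm a = DirectSum.lof K G (fun g => V g) g ⟨a, ha⟩ := by
    rw [LinearEquiv.symm_apply_eq]
    exact (DirectSum.coeLinearMap_lof V g ⟨a, ha⟩).symm
  rw [LinearMap.comp_apply, LinearEquiv.coe_coe, h1, DirectSum.toModule_lof]
  rfl

theorem linearMap_ext_of_iSup_eq_top {ι M : Type*} [AddCommGroup M] [Module K M]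
    {V : ι → Submodule K A} (hs : ⨆ i, V i = ⊤)
    {L L' : A →ₗ[K] M} (h : ∀ i, ∀ a ∈ V i, L a = L' a) : L = L' := by
  have : ⨆ i, V i ≤ LinearMap.eqLocus L L' := iSup_le h
  rw [hs] at this
  exact LinearMap.ext fun a => this trivial

variable [AddCommGroup G]

theorem exists_algHom_smul_of_iSupIndep (hi : iSupIndep V) (hs : ⨆ g, V g = ⊤)
    (h1 : (1 : A) ∈ V 0) (hm : ∀ g h, ∀ a ∈ V g, ∀ b ∈ V h, a * b ∈ V (g + h)) (f : G → K)
    (hf0 : f 0 = 1) (hf : ∀ g h, f (g + h) = f g * f h) :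
    ∃ L : A →ₐ[K] A, ∀ g, ∀ a ∈ V g, L a = f g • a := by
  obtain ⟨L, hL⟩ := exists_linearMap_smul_of_iSupIndep hi hs f
  refine ⟨AlgHom.ofLinearMap L (by rw [hL 0 1 h1, hf0, one_smul]) fun a b => ?_, hL⟩
  -- Multiplicativity is linear in each factor, so it is reduced to homogeneous elements one factor
  -- at a time.
  suffices L ∘ₗ LinearMap.mulRight K b = LinearMap.mulRight K (L b) ∘ₗ L from
    LinearMap.congr_fun this a
  refine linearMap_ext_of_iSup_eq_top hs fun g a ha => ?_
  suffices L ∘ₗ LinearMap.mulLeft K a = LinearMap.mulLeft K (L a) ∘ₗ L from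
    LinearMap.congr_fun this b
  refine linearMap_ext_of_iSup_eq_top hs fun h b hb => ?_
  simp only [LinearMap.comp_apply, LinearMap.mulLeft_apply]
  rw [hL _ _ (hm g h a ha b hb), hL g a ha, hL h b hb, hf, smul_mul_smul_comm]

theorem exists_derivation_smul_of_iSupIndep (hi : iSupIndep V) (hs : ⨆ g, V g = ⊤)
    (hm : ∀ g h, ∀ a ∈ V g, ∀ b ∈ V h, a * b ∈ V (g + h)) (f : G →+ K) :
    ∃ D : Derivation K A A, ∀ g, ∀ a ∈ V g, D a = f g • a := by
  obtain ⟨L, hL⟩ := exists_linearMap_smul_of_iSupIndep hi hs f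
  refine ⟨Derivation.mk' L fun a b => ?_, hL⟩
  suffices L ∘ₗ LinearMap.mulRight K b =
      LinearMap.mulRight K (L b) + LinearMap.mulLeft K b ∘ₗ L from LinearMap.congr_fun this a
  refine linearMap_ext_of_iSup_eq_top hs fun g a ha => ?_
  suffices L ∘ₗ LinearMap.mulLeft K a =
      LinearMap.mulLeft K a ∘ₗ L + LinearMap.mulRight K (L a) from LinearMap.congr_fun this b
  refine linearMap_ext_of_iSup_eq_top hs fun h b hb => ?_
  simp only [LinearMap.comp_apply, LinearMap.mulLeft_apply, LinearMap.add_apply,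
    LinearMap.mulRight_apply]
  rw [hL _ _ (hm g h a ha b hb), hL g a ha, hL h b hb, map_add, add_smul, mul_smul_comm,
    mul_smul_comm, add_comm, mul_comm b a]

/-- The weights of a graded finitely generated algebra lie in a finitely generated group. -/
theorem exists_finite_span_of_ne_bot [Algebra.FiniteType K A] (hi : iSupIndep V)
    (hs : ⨆ g, V g = ⊤) (h1 : (1 : A) ∈ V 0)
    (hm : ∀ g h, ∀ a ∈ V g, ∀ b ∈ V h, a * b ∈ V (g + h)) :
    ∃ F : Set G, F.Finite ∧ {g | V g ≠ ⊥} ⊆ Submodule.span ℤ F := by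
  classical
  obtain ⟨S, hS⟩ := (Algebra.FiniteType.out : (⊤ : Subalgebra K A).FG)
  have hx : ∀ x : A, ∃ F : Finset G, x ∈ ⨆ g ∈ F, V g := fun x =>
    Submodule.mem_iSup_iff_exists_finset.mp (by rw [hs]; trivial)
  choose F hF using hx
  let E : Finset G := S.biUnion F
  let P : Submodule ℤ G := Submodule.span ℤ (E : Set G)
  -- The pieces with degree in `P` span a subalgebra containing the generators, hence all of `A`;
  -- independence then kills every piece of degree outside `P`.
  let W : Submodule K A := ⨆ g : P, V g
  have hW : ∀ g ∈ P, V g ≤ W := fun g hg => le_iSup (fun g : P => V g) ⟨g, hg⟩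
  let B : Subalgebra K A := W.toSubalgebra (hW 0 P.zero_mem h1) (by
    intro a b ha hb
    induction ha using Submodule.iSup_induction' with
    | mem g a ha =>
      induction hb using Submodule.iSup_induction' with
      | mem h b hb => exact hW _ (P.add_mem g.2 h.2) (hm g h a ha b hb)
      | zero => simp
      | add x y _ _ hx hy => rw [mul_add]; exact W.add_mem hx hy
    | zero => simp
    | add x y _ _ hx hy => rw [add_mul]; exact W.add_mem hx hy)
  have hB : B = ⊤ := by
    rw [eq_top_iff, ← hS, Algebra.adjoin_le_iff]
    intro x hx
    refine (iSup₂_le fun g hg => hW g (Submodule.subset_span ?_) : (⨆ g ∈ F x, V g) ≤ W) (hF x)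
    exact Finset.mem_coe.mpr (Finset.mem_biUnion.mpr ⟨x, hx, hg⟩)
  have hWtop : W = ⊤ := by
    rw [eq_top_iff]
    intro a _
    have : a ∈ B := by rw [hB]; trivial
    exact this
  refine ⟨E, E.finite_toSet, fun g hg => ?_⟩
  by_contra hgP
  apply hg
  have h2 : W ≤ ⨆ j, ⨆ (_ : j ≠ g), V j := iSup_le fun j =>
    le_iSup₂_of_le (j : G) (fun h => hgP (h ▸ j.2)) le_rfl
  rw [hWtop, top_le_iff] at h2
  have := hi g
  rwa [h2, disjoint_top] at this

/-- The occurring degrees span a finitely generated torsion-free group, which is free; a basis turns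
the grading into one by `ℤ^s`. -/
theorem exists_regrading [Algebra.FiniteType K A] [IsAddTorsionFree G] (hi : iSupIndep V)
    (hs : ⨆ g, V g = ⊤) (h1 : (1 : A) ∈ V 0)
    (hm : ∀ g h, ∀ a ∈ V g, ∀ b ∈ V h, a * b ∈ V (g + h)) :
    ∃ (s : ℕ) (e : (Fin s → ℤ) →ₗ[ℤ] G), Function.Injective e ∧
      LinearMap.range e = Submodule.span ℤ {g | V g ≠ ⊥} := by
  obtain ⟨F, hF, hFV⟩ := exists_finite_span_of_ne_bot hi hs h1 hm
  let Q : Submodule ℤ G := Submodule.span ℤ {g | V g ≠ ⊥}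
  have hQ : Q ≤ Submodule.span ℤ F := Submodule.span_le.mpr hFV
  have : IsNoetherian ℤ (Submodule.span ℤ F) := isNoetherian_span_of_finite ℤ hF
  have : IsNoetherian ℤ Q := isNoetherian_of_le hQ
  let b := Module.finBasis ℤ Q
  refine ⟨_, Q.subtype ∘ₗ b.equivFun.symm.toLinearMap,
    Q.injective_subtype.comp b.equivFun.symm.injective, ?_⟩
  rw [LinearMap.range_comp, LinearEquiv.range, Submodule.map_top, Submodule.range_subtype]

end Grading

/-! ### From `ℤ^s`-gradings to torus actions -/

section TorusOfGrading

variable {K A : Type*} [Field K] [CommRing A] [Algebra K A] {s : ℕ}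

theorem TorusAction.exists_of_grading {V : (Fin s → ℤ) → Submodule K A} (hi : iSupIndep V)
    (hs : ⨆ g, V g = ⊤) (h1 : (1 : A) ∈ V 0)
    (hm : ∀ g h, ∀ a ∈ V g, ∀ b ∈ V h, a * b ∈ V (g + h)) :
    ∃ ρ : TorusAction K A s, ∀ n, V n ≤ ρ.weightSpace n := by
  choose L hL using fun t : Fin s → Kˣ => exists_algHom_smul_of_iSupIndep hi hs h1 hm
    (fun n => ((torusChar K n t : Kˣ) : K)) (by rw [torusChar_zero, Units.val_one])
    (fun g h => by rw [torusChar_add, Units.val_mul])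
  have hmul : ∀ t u, L (t * u) = (L t).comp (L u) := by
    intro t u
    suffices (L (t * u)).toLinearMap = ((L t).comp (L u)).toLinearMap from
      AlgHom.toLinearMap_injective this
    refine linearMap_ext_of_iSup_eq_top hs fun n a ha => ?_
    simp only [AlgHom.toLinearMap_apply, AlgHom.comp_apply]
    rw [hL _ n a ha, hL u n a ha, map_smul, hL t n a ha, smul_smul, map_mul, Units.val_mul,
      mul_comm]
  have hone : L 1 = AlgHom.id K A := by
    suffices (L 1).toLinearMap = (AlgHom.id K A).toLinearMap from
      AlgHom.toLinearMap_injective this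
    refine linearMap_ext_of_iSup_eq_top hs fun n a ha => ?_
    simp only [AlgHom.toLinearMap_apply, AlgHom.id_apply]
    rw [hL _ n a ha, map_one, Units.val_one, one_smul]
  let ψ : (Fin s → Kˣ) →* (A ≃ₐ[K] A) := MonoidHom.mk' (fun t => AlgEquiv.ofAlgHom (L t) (L t⁻¹)
      (by rw [← hmul, mul_inv_cancel, hone]) (by rw [← hmul, inv_mul_cancel, hone]))
    (fun t u => by
      ext a
      exact DFunLike.congr_fun (hmul t u) a)
  refine ⟨⟨ψ, fun f => ?_⟩, fun n a ha t => hL t n a ha⟩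
  suffices (fun t => ψ t f) ∈ regularFunctions K A s from this
  have hf : f ∈ ⨆ n, V n := by rw [hs]; trivial
  induction hf using Submodule.iSup_induction' with
  | mem n a ha =>
    convert torusChar_smul_mem_regularFunctions n a using 2 with t
    exact hL t n a ha
  | zero =>
    simp only [map_zero]
    exact (regularFunctions K A s).zero_mem
  | add x y _ _ hx hy => simpa [Pi.add_def] using Submodule.add_mem _ hx hy

/-- An element acting trivially is killed by every occurring weight, hence by all characters,
including the coordinates. -/
theorem TorusAction.injective_of_span_eq_top (ρ : TorusAction K A s)
    (h : Submodule.span ℤ {n | ρ.weightSpace n ≠ ⊥} = ⊤) : Function.Injective ρ.toHom := by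
  rw [injective_iff_map_eq_one]
  intro t ht
  have key : ∀ n : Fin s → ℤ, torusChar K n t = 1 := by
    intro n
    have hn : n ∈ Submodule.span ℤ {n | ρ.weightSpace n ≠ ⊥} := by rw [h]; trivial
    induction hn using Submodule.span_induction with
    | mem n hn =>
      obtain ⟨a, ha, ha0⟩ := Submodule.exists_mem_ne_zero_of_ne_bot hn
      have h1 := ha t
      rw [ht, AlgEquiv.one_apply] at h1
      have h2 : (((torusChar K n t : Kˣ) : K) - 1) • a = 0 := by
        rw [sub_smul, ← h1, one_smul, sub_self]
      exact Units.ext (sub_eq_zero.mp ((smul_eq_zero.mp h2).resolve_right ha0))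
    | zero => exact torusChar_zero t
    | add x y _ _ hx hy => rw [torusChar_add, hx, hy, one_mul]
    | smul k x _ hx => rw [torusChar_zsmul, hx, one_zpow]
  ext i
  rw [← torusChar_single i t, key, Pi.one_apply]

variable [CharZero K]

theorem TorusAction.isDifferential_of_weight (ρ : TorusAction K A s) {v : Fin s → K}
    {σ : Derivation K A A}
    (h : ∀ n, ∀ a ∈ ρ.weightSpace n, σ a = (∑ i, (n i : K) * v i) • a) :
    ρ.IsDifferential v σ := by
  intro f c hc
  have h1 : f = laurentEval c (1 : Fin s → Kˣ) := by rw [← hc, map_one]; rfl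
  rw [h1, laurentEval, map_finsuppSum, laurentDeriv]
  refine Finsupp.sum_congr fun n _ => ?_
  rw [map_one, Units.val_one, one_smul]
  exact h n _ fun t => ρ.coeff_weight hc n t

theorem TorusAction.exists_isDifferential (ρ : TorusAction K A s) (v : Fin s → K) :
    ∃ σ : Derivation K A A, ρ.IsDifferential v σ := by
  obtain ⟨σ, hσ⟩ := exists_derivation_smul_of_iSupIndep ρ.iSupIndep_weightSpace
    ρ.iSup_weightSpace (fun g h a ha b hb => TorusAction.mul_mem_weightSpace ha hb)
    { toFun := fun n => ∑ i, (n i : K) * v i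
      map_zero' := by simp
      map_add' := fun m n => by simp [add_mul, Finset.sum_add_distrib] }
  exact ⟨σ, ρ.isDifferential_of_weight hσ⟩

end TorusOfGrading

/-! ### Jordan decomposition compatible with a torus -/

section Jordan

variable {K A : Type*} [Field K] [CommRing A] [Algebra K A] {r : ℕ}

/-- By the Leibniz rule, `δ - (μ + ν)` sends `a * b` to `(δ - μ)a * b + a * (δ - ν)b`, and each term
lowers `k + l` by one. -/
theorem pow_sub_smul_one_apply_mul_eq_zero (δ : Derivation K A A) (μ ν : K) (n : ℕ) :
    ∀ (k l : ℕ) (a b : A), k + l ≤ n →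
      (((δ : Module.End K A) - μ • (1 : Module.End K A)) ^ k) a = 0 →
      (((δ : Module.End K A) - ν • (1 : Module.End K A)) ^ l) b = 0 →
      (((δ : Module.End K A) - (μ + ν) • (1 : Module.End K A)) ^ n) (a * b) = 0 := by
  induction n with
  | zero =>
    intro k l a b hkl ha _
    obtain rfl : k = 0 := by omega
    have ha : a = 0 := by simpa using ha
    rw [ha, zero_mul, map_zero]
  | succ n ih =>
    intro k l a b hkl ha hb
    rcases k with _ | k
    · have ha : a = 0 := by simpa using ha
      rw [ha, zero_mul, map_zero]
    rcases l with _ | l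
    · have hb : b = 0 := by simpa using hb
      rw [hb, mul_zero, map_zero]
    have h1 : ((δ : Module.End K A) - (μ + ν) • (1 : Module.End K A)) (a * b) =
        ((δ : Module.End K A) - μ • (1 : Module.End K A)) a * b +
        a * ((δ : Module.End K A) - ν • (1 : Module.End K A)) b := by
      simp only [LinearMap.sub_apply, LinearMap.smul_apply, Module.End.one_apply,
        Derivation.coeFn_coe, Derivation.leibniz, smul_eq_mul, sub_mul, mul_sub, add_smul,
        LinearMap.add_apply, smul_mul_assoc, mul_smul_comm]
      ring
    rw [pow_succ, Module.End.mul_apply, h1, map_add,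
      ih k (l + 1) _ b (by omega) (by rwa [pow_succ, Module.End.mul_apply] at ha) hb,
      ih (k + 1) l a _ (by omega) ha (by rwa [pow_succ, Module.End.mul_apply] at hb), add_zero]

theorem mul_mem_maxGenEigenspace (δ : Derivation K A A) {μ ν : K} {a b : A}
    (ha : a ∈ Module.End.maxGenEigenspace (δ : Module.End K A) μ)
    (hb : b ∈ Module.End.maxGenEigenspace (δ : Module.End K A) ν) :
    a * b ∈ Module.End.maxGenEigenspace (δ : Module.End K A) (μ + ν) := by
  rw [Module.End.mem_maxGenEigenspace] at ha hb ⊢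
  obtain ⟨k, hk⟩ := ha
  obtain ⟨l, hl⟩ := hb
  exact ⟨k + l, pow_sub_smul_one_apply_mul_eq_zero δ μ ν _ k l a b le_rfl hk hl⟩

theorem le_iSup_inf_maxGenEigenspace [IsAlgClosed K] (D : Module.End K A) (W : Submodule K A)
    [FiniteDimensional K W] (hW : ∀ w ∈ W, D w ∈ W) : W ≤ ⨆ μ, W ⊓ D.maxGenEigenspace μ := by
  have h := Module.End.iSup_maxGenEigenspace_eq_top (D.restrict hW)
  calc W = (⨆ μ, Module.End.maxGenEigenspace (D.restrict hW) μ).map W.subtype := by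
        rw [h, Submodule.map_top, Submodule.range_subtype]
    _ ≤ _ := by
        rw [Submodule.map_iSup]
        refine iSup_mono fun μ => le_inf (Submodule.map_subtype_le _ _) ?_
        rw [Module.End.maxGenEigenspace, Module.End.genEigenspace_restrict]
        exact Submodule.map_comap_le _ _

theorem isLocallyNilpotent_of_iSup_eq_top {ι : Type*} {V : ι → Submodule K A}
    (hV : ⨆ i, V i = ⊤) {δ : Derivation K A A} (h : ∀ i, ∀ a ∈ V i, ∃ n : ℕ, (⇑δ)^[n] a = 0) :
    IsLocallyNilpotent δ := by
  intro a
  have ha : a ∈ ⨆ i, V i := by rw [hV]; trivial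
  induction ha using Submodule.iSup_induction' with
  | mem i a ha => exact h i a ha
  | zero => exact ⟨0, rfl⟩
  | add x y _ _ hx hy =>
    obtain ⟨n, hn⟩ := hx
    obtain ⟨m, hm⟩ := hy
    exact ⟨max n m, by rw [iterate_map_add, iterate_eq_zero_of_le hn (le_max_left n m),
      iterate_eq_zero_of_le hm (le_max_right n m), add_zero]⟩

variable [CharZero K]

/-- Jordan decomposition of a locally finite derivation commuting with a torus: the semisimple part
is tangent to a torus containing the given one. -/
theorem TorusAction.exists_jordan [IsAlgClosed K] [Algebra.FiniteType K A] (ρ : TorusAction K A r)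
    {δ : Derivation K A A} (hδ : IsLocallyFinite δ)
    (hρδ : ∀ t a, ρ.toHom t (δ a) = δ (ρ.toHom t a)) :
    ∃ (s : ℕ) (ρ' : TorusAction K A s), Function.Injective ρ'.toHom ∧
      ρ.toHom.range ≤ ρ'.toHom.range ∧ ∃ σ ∈ ρ'.lieAlgebra, IsLocallyNilpotent (δ - σ) := by
  let D : Module.End K A := (δ : A →ₗ[K] A)
  let V : (Fin r → ℤ) × K → Submodule K A := fun w =>
    ρ.weightSpace w.1 ⊓ D.maxGenEigenspace w.2
  have hi : iSupIndep V := ρ.iSupIndep_weightSpace_inf_maxGenEigenspace D hρδ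
  have hs : ⨆ w, V w = ⊤ := by
    rw [eq_top_iff, ← ρ.iSup_weightSpace]
    refine iSup_le fun m a ha => ?_
    obtain ⟨W, hWf, haW, hW⟩ := hδ a
    have hstab : ∀ w ∈ ρ.weightSpace m ⊓ W, D w ∈ ρ.weightSpace m ⊓ W := fun w hw =>
      ⟨fun t => by
        change ρ.toHom t (δ w) = _ • δ w
        rw [hρδ, hw.1 t, Derivation.map_smul], hW w hw.2⟩
    refine (le_iSup_inf_maxGenEigenspace D _ hstab).trans ?_ ⟨ha, haW⟩
    exact iSup_le fun μ => le_iSup_of_le (m, μ) (inf_le_inf_right _ inf_le_left)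
  have h1 : (1 : A) ∈ V 0 := ⟨ρ.one_mem_weightSpace,
    Module.End.eigenspace_le_maxGenEigenspace (Module.End.mem_eigenspace_iff.mpr (by simp [D]))⟩
  have hm : ∀ g h, ∀ a ∈ V g, ∀ b ∈ V h, a * b ∈ V (g + h) := fun g h a ha b hb =>
    ⟨TorusAction.mul_mem_weightSpace ha.1 hb.1, mul_mem_maxGenEigenspace δ ha.2 hb.2⟩
  -- The degrees are pairs (weight, eigenvalue) in `ℤ^r × K`, which is torsion-free because `K` has
  -- characteristic zero.
  obtain ⟨s, e, he, hrange⟩ := exists_regrading hi hs h1 hm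
  have hVe : ∀ w, V w ≠ ⊥ → ∃ n, e n = w := fun w hw => by
    have : w ∈ LinearMap.range e := hrange ▸ Submodule.subset_span hw
    exact this
  have hs' : ⨆ n, V (e n) = ⊤ := by
    rw [eq_top_iff, ← hs]
    refine iSup_le fun w => ?_
    by_cases hw : V w = ⊥
    · rw [hw]; exact bot_le
    · obtain ⟨n, rfl⟩ := hVe w hw
      exact le_iSup (fun n => V (e n)) n
  obtain ⟨ρ', hρ'⟩ := TorusAction.exists_of_grading (V := fun n => V (e n)) (hi.comp he) hs'
    (by rw [map_zero]; exact h1)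
    (fun g h a ha b hb => by rw [map_add]; exact hm _ _ a ha b hb)
  have hesum : ∀ n : Fin s → ℤ, e n = ∑ i, n i • e (Pi.single i 1) := by
    intro n
    conv_lhs => rw [pi_eq_sum_univ' n]
    simp only [map_sum, map_smul]
  -- This tangent vector is chosen so that `σ` acts on each piece by its generalized eigenvalue of
  -- `δ`.
  obtain ⟨σ, hσ⟩ := ρ'.exists_isDifferential fun i => (e (Pi.single i 1)).2
  have hσw : ∀ n, ∀ a ∈ V (e n), σ a = (e n).2 • a := by
    intro n a ha
    rw [hσ.apply_weight (hρ' n ha), hesum n, Prod.snd_sum]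
    simp
  refine ⟨s, ρ', ρ'.injective_of_span_eq_top ?_, ?_, σ, ⟨_, hσ⟩, ?_⟩
  · rw [eq_top_iff]
    intro n _
    have hn : e n ∈ Submodule.span ℤ {w | V w ≠ ⊥} := hrange ▸ ⟨n, rfl⟩
    have hsub : {w | V w ≠ ⊥} ⊆ e '' {n | ρ'.weightSpace n ≠ ⊥} := by
      intro w hw
      obtain ⟨m, rfl⟩ := hVe w hw
      exact ⟨m, fun h => hw (eq_bot_iff.mpr (h ▸ hρ' m)), rfl⟩
    have := Submodule.span_mono hsub hn
    rw [← Submodule.map_span] at this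
    obtain ⟨m, hm, hmn⟩ := this
    rwa [← he hmn]
  · rintro _ ⟨t, rfl⟩
    -- The first coordinate of `e` restricts degrees to `ρ`-weights; its dual is the map of tori
    -- giving `ρ(t)` as an element of the new torus.
    refine ⟨fun i => torusChar K (e (Pi.single i 1)).1 t, ?_⟩
    ext a
    refine LinearMap.congr_fun (linearMap_ext_of_iSup_eq_top
      (L := (ρ'.toHom fun i => torusChar K (e (Pi.single i 1)).1 t).toLinearMap)
      (L' := (ρ.toHom t).toLinearMap) hs' fun n a ha => ?_) a
    rw [AlgEquiv.toLinearMap_apply, AlgEquiv.toLinearMap_apply, ha.1 t, hρ' n ha]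
    congr 2
    rw [hesum n, Prod.fst_sum]
    simp only [Prod.smul_fst, torusChar_sum, torusChar_zsmul]
    rfl
  · refine isLocallyNilpotent_of_iSup_eq_top hs' fun n a ha => ?_
    obtain ⟨k, hk⟩ := (Module.End.mem_maxGenEigenspace _ _ _).mp ha.2
    refine ⟨k, ?_⟩
    rw [← hk]
    -- On a single piece `σ` is the eigenvalue, so `δ - σ` iterates as `D` minus that scalar, which
    -- is nilpotent on each vector.
    have hstab : ∀ j : ℕ, (⇑(δ - σ))^[j] a = ((D - (e n).2 • (1 : Module.End K A)) ^ j) a ∧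
        (⇑(δ - σ))^[j] a ∈ V (e n) := by
      intro j
      induction j with
      | zero => exact ⟨rfl, ha⟩
      | succ j ih =>
        have h2 : (δ - σ) ((⇑(δ - σ))^[j] a) =
            (D - (e n).2 • (1 : Module.End K A)) ((⇑(δ - σ))^[j] a) := by
          rw [Derivation.sub_apply, hσw n _ ih.2]
          rfl
        rw [Function.iterate_succ_apply', pow_succ', Module.End.mul_apply, ← ih.1]
        refine ⟨h2, ?_⟩
        rw [h2]
        refine Submodule.sub_mem _ ⟨fun t => ?_, ?_⟩ (Submodule.smul_mem _ _ ih.2)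
        · change ρ.toHom t (δ _) = _ • δ _
          rw [hρδ, ih.2.1 t, Derivation.map_smul]
        · exact Module.End.mapsTo_maxGenEigenspace_of_comm (Commute.refl D) _ ih.2.2
    exact (hstab k).1

end Jordan

/-! ### Locally finite derivations modulo locally nilpotent ones -/

section LocallyFinite

variable {K A : Type*} [Field K] [CommRing A] [Algebra K A] {r : ℕ}

theorem exists_le_of_monotone {ι : Type*} [Preorder ι] [IsDirectedOrder ι] [Nonempty ι]
    {U : ι → Submodule K A} (hU : Monotone U) (hx : ∀ x, ∃ i, x ∈ U i) (W : Submodule K A)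
    [FiniteDimensional K W] : ∃ i, W ≤ U i := by
  classical
  obtain ⟨S, hS⟩ := (Module.Finite.iff_fg.mp ‹FiniteDimensional K W› : W.FG)
  choose N hN using hx
  obtain ⟨M, hM⟩ := (S.image N).exists_le
  refine ⟨M, ?_⟩
  rw [← hS, Submodule.span_le]
  exact fun x hx => hU (hM _ (Finset.mem_image_of_mem N hx)) (hN x)

/-- The smallest subspace containing `W` and stable under a locally nilpotent operator is
finite-dimensional. -/
theorem finiteDimensional_iSup_map_pow (N : Module.End K A) (hN : ∀ a, ∃ n : ℕ, (N ^ n) a = 0)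
    (W : Submodule K A) [FiniteDimensional K W] :
    FiniteDimensional K (⨆ n : ℕ, W.map (N ^ n) : Submodule K A) := by
  have hker : ∀ {i j : ℕ}, i ≤ j → ∀ a, (N ^ i) a = 0 → (N ^ j) a = 0 := by
    intro i j hij a ha
    rw [← Nat.sub_add_cancel hij, pow_add, Module.End.mul_apply, ha, map_zero]
  obtain ⟨n, hn⟩ := exists_le_of_monotone (U := fun n : ℕ => LinearMap.ker (N ^ n))
    (fun i j hij a ha => hker hij a ha) hN W
  have hle : (⨆ n : ℕ, W.map (N ^ n)) ≤ ⨆ i : Fin n, W.map (N ^ (i : ℕ)) := by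
    refine iSup_le fun j => ?_
    rcases lt_or_ge j n with hj | hj
    · exact le_iSup (fun i : Fin n => W.map (N ^ (i : ℕ))) ⟨j, hj⟩
    · rintro _ ⟨w, hw, rfl⟩
      rw [hker hj w (hn hw)]
      exact Submodule.zero_mem _
  exact Submodule.finiteDimensional_of_le hle

/-- The `c i` are adjoined one at a time, replacing `W` by the sum of all `(c i)^n W`. Stability
under `δ` survives since `δ` only rescales `c i` under the bracket, and stability under earlier `c
j` since they commute with `c i`. -/
theorem exists_stable_subspace {ι : Type*} {δ : Derivation K A A} (hδ : IsLocallyFinite δ)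
    (c : ι → Derivation K A A) (hc : ∀ i, IsLocallyNilpotent (c i)) (hcc : ∀ i j, ⁅c i, c j⁆ = 0)
    (k : ι → K) (hk : ∀ i, ⁅δ, c i⁆ = k i • c i) (F : Finset ι) (f : A) :
    ∃ W : Submodule K A, FiniteDimensional K W ∧ f ∈ W ∧ (∀ w ∈ W, δ w ∈ W) ∧
      ∀ i ∈ F, ∀ w ∈ W, c i w ∈ W := by
  classical
  induction F using Finset.induction_on with
  | empty =>
    obtain ⟨W, h1, h2, h3⟩ := hδ f
    exact ⟨W, h1, h2, h3, by simp⟩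
  | insert i F _ ih =>
    obtain ⟨W, hWf, hfW, hWδ, hWc⟩ := ih
    let N : Module.End K A := (c i : A →ₗ[K] A)
    let W' : Submodule K A := ⨆ n : ℕ, W.map (N ^ n)
    have hmem : ∀ n : ℕ, ∀ w ∈ W, (N ^ n) w ∈ W' := fun n w hw =>
      le_iSup (fun n : ℕ => W.map (N ^ n)) n ⟨w, hw, rfl⟩
    have hstab : ∀ D : Module.End K A, (∀ n : ℕ, ∀ w ∈ W, D ((N ^ n) w) ∈ W') →
        ∀ w ∈ W', D w ∈ W' := by
      intro D hD
      have : W' ≤ W'.comap D := iSup_le fun n => by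
        rintro _ ⟨w, hw, rfl⟩
        exact hD n w hw
      exact this
    refine ⟨W', finiteDimensional_iSup_map_pow N (fun a => ?_) W, hmem 0 f hfW, ?_, ?_⟩
    · obtain ⟨n, hn⟩ := hc i a
      exact ⟨n, by rw [← hn, iterate_eq_pow_apply]⟩
    · have hpow : ∀ (n : ℕ) (w : A), δ ((N ^ n) w) = (N ^ n) (δ w) + ((n : K) * k i) • (N ^ n) w := by
        intro n w
        induction n with
        | zero => simp
        | succ n ih =>
          have h1 : ∀ x, δ (N x) = N (δ x) + k i • N x := fun x => by
            have := DFunLike.congr_fun (hk i) x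
            rw [Derivation.commutator_apply, Derivation.smul_apply] at this
            exact sub_eq_iff_eq_add'.mp this
          rw [pow_succ', Module.End.mul_apply, Module.End.mul_apply, h1, ih, map_add, map_smul,
            add_assoc, ← add_smul]
          push_cast
          ring_nf
      refine hstab (δ : A →ₗ[K] A) fun n w hw => ?_
      rw [Derivation.coeFn_coe, hpow]
      exact W'.add_mem (hmem n _ (hWδ w hw)) (W'.smul_mem _ (hmem n w hw))
    · intro j hj
      rcases Finset.mem_insert.mp hj with rfl | hj
      · refine hstab (c j : A →ₗ[K] A) fun n w hw => ?_
        have := hmem (n + 1) w hw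
        rwa [pow_succ', Module.End.mul_apply] at this
      · refine hstab (c j : A →ₗ[K] A) fun n w hw => ?_
        have hcomm := (commute_of_lie_eq_zero (hcc j i)).pow_right n
        rw [← Module.End.mul_apply, hcomm.eq, Module.End.mul_apply]
        exact hmem n _ (hWc j hj w hw)

variable [CharZero K]

/-- The nilpotent Jordan part of `δ` commutes with every locally nilpotent derivation. So `δ`
brackets like its semisimple part, under which the weight components of `ν` are eigenvectors, and
common finite-dimensional stable subspaces exist. -/
theorem IsLocallyFinite.add_isLocallyNilpotent [IsAlgClosed K] [Algebra.FiniteType K A]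
    (hU : ∀ g ∈ unipotentGroup K A, ∀ h ∈ unipotentGroup K A, g * h = h * g)
    {δ ν : Derivation K A A} (hδ : IsLocallyFinite δ) (hν : IsLocallyNilpotent ν) :
    IsLocallyFinite (δ + ν) := by
  -- With the trivial torus of rank 0, `TorusAction.exists_jordan` is the plain Jordan
  -- decomposition.
  let ρ₀ : TorusAction K A 0 := ⟨1, fun f => ⟨Finsupp.single 0 f, fun t => by
    rw [laurentEval_single, torusChar_zero]; simp⟩⟩
  obtain ⟨s, ρ, -, -, σ, ⟨v, hv⟩, hσ⟩ := ρ₀.exists_jordan hδ (fun _ _ => rfl)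
  obtain ⟨c, hc, hcw, hsum⟩ := ρ.exists_derivation_decomposition ν
  have hcn : ∀ m, IsLocallyNilpotent (c m) := fun m =>
    ρ.isLocallyNilpotent_of_mem_span_conj hU hν (hc m)
  intro f
  obtain ⟨W, hWf, hfW, hWδ, hWc⟩ := exists_stable_subspace hδ c hcn
    (fun i j => lie_eq_zero_of_unipotentGroup_comm hU (hcn i) (hcn j))
    (fun m => ∑ i, (m i : K) * v i) (fun m => by
      rw [← hv.lie_eq_smul (hcw m), ← sub_eq_zero, ← sub_lie]
      exact lie_eq_zero_of_unipotentGroup_comm hU hσ (hcn m)) c.support f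
  refine ⟨W, hWf, hfW, fun w hw => ?_⟩
  rw [Derivation.add_apply, hsum, Finsupp.sum, sum_derivation_apply]
  exact W.add_mem (hWδ w hw) (W.sum_mem fun m hm => hWc m hm w hw)

/-- An extremal nonzero weight component of a locally finite derivation is locally nilpotent. -/
theorem TorusAction.isLocallyNilpotent_of_extremal (ρ : TorusAction K A r)
    {δ : Derivation K A A} (hδ : IsLocallyFinite δ) {c : (Fin r → ℤ) →₀ Derivation K A A}
    (hcw : ∀ m t, conj (ρ.toHom t) (c m) = ((torusChar K m t : Kˣ) : K) • c m)
    (hsum : δ = c.sum fun _ ε => ε) (ℓ : (Fin r → ℤ) →+ ℤ) {p : Fin r → ℤ} (hp : 0 < ℓ p)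
    (hmax : ∀ m ∈ c.support, m ≠ p → ℓ m < ℓ p) : IsLocallyNilpotent (c p) := by
  classical
  -- The filtration of `A` by `ℓ`-degree: `c p` raises the degree by exactly `ℓ p`, all other
  -- components by strictly less.
  let U : ℤ → Submodule K A := fun N => ⨆ k : {k : Fin r → ℤ // ℓ k < N}, ρ.weightSpace k
  have hUmem : ∀ {N : ℤ} {k : Fin r → ℤ}, ℓ k < N → ρ.weightSpace k ≤ U N := fun {N k} h =>
    le_iSup (fun k : {k : Fin r → ℤ // ℓ k < N} => ρ.weightSpace k) ⟨k, h⟩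
  have hUmono : Monotone U := fun N M h => iSup_le fun k => hUmem (k.2.trans_le h)
  have hUx : ∀ x, ∃ N, x ∈ U N := by
    intro x
    have hx : x ∈ ⨆ m, ρ.weightSpace m := by rw [ρ.iSup_weightSpace]; trivial
    induction hx using Submodule.iSup_induction' with
    | mem m a ha => exact ⟨ℓ m + 1, hUmem (lt_add_one _) ha⟩
    | zero => exact ⟨0, Submodule.zero_mem _⟩
    | add x y _ _ hx hy =>
      obtain ⟨N, hN⟩ := hx
      obtain ⟨M, hM⟩ := hy
      exact ⟨max N M, Submodule.add_mem _ (hUmono (le_max_left _ _) hN)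
        (hUmono (le_max_right _ _) hM)⟩
  have hcp : ∀ k, ∀ x ∈ ρ.weightSpace k, c p x ∈ ρ.weightSpace (p + k) := fun k x hx =>
    TorusAction.apply_mem_weightSpace (hcw p) hx
  have hsub : ∀ k, ∀ x ∈ ρ.weightSpace k, δ x - c p x ∈ U (ℓ p + ℓ k) := by
    intro k x hx
    have h1 : δ x - c p x = ∑ m ∈ c.support.erase p, c m x := by
      rw [hsum, Finsupp.sum, sum_derivation_apply]
      by_cases hps : p ∈ c.support
      · rw [← Finset.add_sum_erase _ _ hps, add_sub_cancel_left]
      · rw [Finset.erase_eq_of_notMem hps, Finsupp.notMem_support_iff.mp hps,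
          Derivation.zero_apply, sub_zero]
    rw [h1]
    refine Submodule.sum_mem _ fun m hm => ?_
    obtain ⟨hmp, hm⟩ := Finset.mem_erase.mp hm
    refine hUmem ?_ (TorusAction.apply_mem_weightSpace (hcw m) hx)
    rw [map_add]
    exact add_lt_add_left (hmax m hm hmp) _
  have hδU : ∀ N, ∀ x ∈ U N, δ x ∈ U (ℓ p + N) := by
    intro N
    suffices U N ≤ (U (ℓ p + N)).comap (δ : A →ₗ[K] A) from this
    refine iSup_le fun k x hx => ?_
    have h1 : δ x = (δ x - c p x) + c p x := by rw [sub_add_cancel]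
    rw [Submodule.mem_comap, Derivation.coeFn_coe, h1]
    refine Submodule.add_mem _ (hUmono ?_ (hsub k x hx)) (hUmem ?_ (hcp k x hx))
    · exact add_le_add_right k.2.le _
    · rw [map_add]; exact add_lt_add_right k.2 _
  refine isLocallyNilpotent_of_iSup_eq_top ρ.iSup_weightSpace fun k a ha => ?_
  -- `(c p)^n a` is the leading term of `δ^n a`.
  have key : ∀ n : ℕ, (⇑(c p))^[n] a ∈ ρ.weightSpace (n • p + k) ∧
      (⇑δ)^[n] a - (⇑(c p))^[n] a ∈ U (n * ℓ p + ℓ k) := by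
    intro n
    induction n with
    | zero => simpa using ha
    | succ n ih =>
      simp only [Function.iterate_succ_apply']
      constructor
      · convert hcp _ _ ih.1 using 2
        rw [succ_nsmul']
        abel
      · have h1 : δ ((⇑δ)^[n] a) - c p ((⇑(c p))^[n] a) =
            δ ((⇑δ)^[n] a - (⇑(c p))^[n] a) +
              (δ ((⇑(c p))^[n] a) - c p ((⇑(c p))^[n] a)) := by
          rw [map_sub]; abel
        have h2 : ((n + 1 : ℕ) : ℤ) * ℓ p + ℓ k = ℓ p + (n * ℓ p + ℓ k) := by
          push_cast; ring
        rw [h1, h2]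
        refine Submodule.add_mem _ (hδU _ _ ih.2) ?_
        convert hsub _ _ ih.1 using 3
        rw [map_add, map_nsmul, nsmul_eq_mul]
  obtain ⟨W, hWf, haW, hW⟩ := hδ a
  obtain ⟨N, hN⟩ := exists_le_of_monotone hUmono hUx W
  have hiter : ∀ n : ℕ, (⇑δ)^[n] a ∈ W := by
    intro n
    induction n with
    | zero => exact haW
    | succ n ih => rw [Function.iterate_succ_apply']; exact hW _ ih
  -- Since `ℓ p ≥ 1`, this many steps push the leading degree to at least `N`, while the orbit of
  -- `a` stays in `W ≤ U N`; the leading term must vanish.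
  let n : ℕ := (N - ℓ k).toNat
  have hn : N ≤ n * ℓ p + ℓ k := by
    have h1 : N - ℓ k ≤ n := Int.self_le_toNat _
    have h2 : (n : ℤ) * 1 ≤ n * ℓ p := mul_le_mul_of_nonneg_left hp (Int.natCast_nonneg n)
    linarith
  refine ⟨n, ?_⟩
  have hmem : (⇑(c p))^[n] a ∈ U (n * ℓ p + ℓ k) := by
    have := Submodule.sub_mem _ (hUmono hn (hN (hiter n))) (key n).2
    rwa [sub_sub_cancel] at this
  have hle : U (n * ℓ p + ℓ k) ≤ ⨆ j, ⨆ (_ : j ≠ n • p + k), ρ.weightSpace j := by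
    refine iSup_le fun j => le_iSup₂_of_le (j : Fin r → ℤ) (fun h => ?_) le_rfl
    have := j.2
    rw [h, map_add, map_nsmul, nsmul_eq_mul] at this
    exact lt_irrefl _ this
  exact Submodule.disjoint_def.mp (ρ.iSupIndep_weightSpace (n • p + k)) _ (key n).1 (hle hmem)

/-- In a finite set of lattice points, a point of maximal norm is exposed. -/
theorem exists_extremal {F : Finset (Fin r → ℤ)} (hF : (F.erase 0).Nonempty) :
    ∃ p ∈ F, p ≠ 0 ∧ ∃ ℓ : (Fin r → ℤ) →+ ℤ, 0 < ℓ p ∧ ∀ m ∈ F, m ≠ p → ℓ m < ℓ p := by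
  obtain ⟨p, hpF, hp⟩ := (F.erase 0).exists_max_image (fun m => ∑ i, m i * m i) hF
  obtain ⟨hp0, hpF⟩ := Finset.mem_erase.mp hpF
  have hpos : ∀ m : Fin r → ℤ, m ≠ 0 → 0 < ∑ i, m i * m i := by
    intro m hm
    obtain ⟨i, hi⟩ := Function.ne_iff.mp hm
    exact Finset.sum_pos' (fun j _ => mul_self_nonneg _) ⟨i, Finset.mem_univ i,
      mul_self_pos.mpr hi⟩
  refine ⟨p, hpF, hp0,
    { toFun := fun m => ∑ i, m i * p i
      map_zero' := by simp
      map_add' := fun m n => by simp [add_mul, Finset.sum_add_distrib] }, hpos p hp0, ?_⟩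
  intro m hm hmp
  have h1 : ∑ i, m i * m i ≤ ∑ i, p i * p i := by
    by_cases hm0 : m = 0
    · rw [hm0]
      simpa using (hpos p hp0).le
    · exact hp m (Finset.mem_erase.mpr ⟨hm0, hm⟩)
  -- Expanding `|m - p|² > 0` with `|m| ≤ |p|` gives `⟨m, p⟩ < |p|²`.
  have h2 := hpos (m - p) (sub_ne_zero.mpr hmp)
  have h3 : ∑ i, (m - p) i * (m - p) i =
      ∑ i, m i * m i + ∑ i, p i * p i - 2 * ∑ i, m i * p i := by
    rw [Finset.mul_sum, ← Finset.sum_add_distrib, ← Finset.sum_sub_distrib]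
    refine Finset.sum_congr rfl fun i _ => ?_
    rw [Pi.sub_apply]
    ring
  rw [h3] at h2
  change ∑ i, m i * p i < ∑ i, p i * p i
  linarith

/-- Induction on the number of weight components: an exposed nonzero weight is peeled off as long as
one exists. Once only weight 0 remains, the derivation is invariant under the torus. -/
theorem TorusAction.exists_sub_commutes_of_decomposition [IsAlgClosed K] [Algebra.FiniteType K A]
    (hU : ∀ g ∈ unipotentGroup K A, ∀ h ∈ unipotentGroup K A, g * h = h * g)
    (ρ : TorusAction K A r) (n : ℕ) :
    ∀ (δ : Derivation K A A), IsLocallyFinite δ → ∀ c : (Fin r → ℤ) →₀ Derivation K A A,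
      (∀ m t, conj (ρ.toHom t) (c m) = ((torusChar K m t : Kˣ) : K) • c m) →
      (δ = c.sum fun _ ε => ε) → c.support.card ≤ n →
      ∃ ν, IsLocallyNilpotent ν ∧ IsLocallyFinite (δ - ν) ∧
        ∀ t, conj (ρ.toHom t) (δ - ν) = δ - ν := by
  classical
  induction n with
  | zero =>
    intro δ hδ c _ hsum hcard
    rw [Nat.le_zero, Finset.card_eq_zero, Finsupp.support_eq_empty] at hcard
    have h0 : δ = 0 := by rw [hsum, hcard, Finsupp.sum_zero_index]
    refine ⟨0, IsLocallyNilpotent.zero, by rwa [sub_zero], fun t => ?_⟩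
    rw [h0, sub_zero]
    ext a
    simp [conj_apply]
  | succ n ih =>
    intro δ hδ c hcw hsum hcard
    by_cases hF : (c.support.erase 0).Nonempty
    · obtain ⟨p, hpc, -, ℓ, hp, hℓ⟩ := exists_extremal hF
      have hnil := ρ.isLocallyNilpotent_of_extremal hδ hcw hsum ℓ hp hℓ
      obtain ⟨ν, hν, hfin, hcomm⟩ := ih (δ - c p)
        (by
          have := hδ.add_isLocallyNilpotent hU (hnil.smul (-1 : K))
          rwa [neg_one_smul, ← sub_eq_add_neg] at this)
        (c.erase p) (fun m t => by
          rcases eq_or_ne m p with rfl | hm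
          · rw [Finsupp.erase_same, smul_zero]
            ext a
            simp [conj_apply]
          · rw [Finsupp.erase_ne hm, hcw])
        (by rw [hsum, ← Finsupp.add_sum_erase c p (fun _ ε => ε) hpc, add_sub_cancel_left])
        (by
          rw [Finsupp.support_erase, Finset.card_erase_of_mem hpc]
          omega)
      refine ⟨c p + ν, hnil.add hν (lie_eq_zero_of_unipotentGroup_comm hU hnil hν), ?_, ?_⟩
      · rwa [← sub_sub]
      · rwa [← sub_sub]
    · refine ⟨0, IsLocallyNilpotent.zero, by rwa [sub_zero], fun t => ?_⟩
      have hc : ∀ m, m ≠ 0 → c m = 0 := fun m hm => by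
        by_contra h
        exact hF ⟨m, Finset.mem_erase.mpr ⟨hm, Finsupp.mem_support_iff.mpr h⟩⟩
      have h0 : δ = c 0 := by
        rw [hsum, Finsupp.sum, Finset.sum_eq_single 0 (fun m _ hm => hc m hm)
          (fun h => Finsupp.notMem_support_iff.mp h)]
      rw [sub_zero, h0, hcw, torusChar_zero, Units.val_one, one_smul]

/-- Up to a locally nilpotent derivation, a locally finite derivation commutes with any torus. -/
theorem TorusAction.exists_sub_commutes [IsAlgClosed K] [Algebra.FiniteType K A]
    (hU : ∀ g ∈ unipotentGroup K A, ∀ h ∈ unipotentGroup K A, g * h = h * g)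
    (ρ : TorusAction K A r) {δ : Derivation K A A} (hδ : IsLocallyFinite δ) :
    ∃ ν, IsLocallyNilpotent ν ∧ IsLocallyFinite (δ - ν) ∧
      ∀ t a, ρ.toHom t ((δ - ν) a) = (δ - ν) (ρ.toHom t a) := by
  obtain ⟨c, -, hcw, hsum⟩ := ρ.exists_derivation_decomposition δ
  obtain ⟨ν, h1, h2, h3⟩ := ρ.exists_sub_commutes_of_decomposition hU _ δ hδ c hcw hsum le_rfl
  exact ⟨ν, h1, h2, TorusAction.conj_eq_self_iff.mp h3⟩

end LocallyFinite

/-! ### Lie algebras of nested subtori -/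

section Subtorus

variable {K A : Type*} [Field K] [CharZero K] [CommRing A] [Algebra K A] {r s : ℕ}

/-- A nonzero function on which a torus acts by scalars is a weight vector. -/
theorem TorusAction.exists_mem_weightSpace (ρ : TorusAction K A s) {a : A} (ha0 : a ≠ 0)
    (f : (Fin s → Kˣ) → K) (hf : ∀ t, ρ.toHom t a = f t • a) : ∃ n, a ∈ ρ.weightSpace n := by
  obtain ⟨c, hc⟩ := ρ.regular a
  have hc0 : c ≠ 0 := by
    rintro rfl
    apply ha0
    have := hc 1
    rw [map_one, laurentEval, Finsupp.sum_zero_index] at this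
    exact this
  obtain ⟨n, hn⟩ := Finsupp.support_nonempty_iff.mpr hc0
  have hcn := Finsupp.mem_support_iff.mp hn
  -- A combination of the values `ρ(t)a`, all multiples of `a`, isolates the nonzero coefficient `c
  -- n`; so `a` is proportional to a weight vector.
  obtain ⟨k, hk⟩ := exists_dual_torusChar (K := K) c.support (Pi.single n 1)
  have h1 : c n = (∑ t ∈ k.support, k t * f t) • a := by
    calc c n = ∑ m ∈ c.support, (Pi.single n 1 : (Fin s → ℤ) → K) m • c m := by
          rw [Finset.sum_eq_single n (fun m _ hm => by simp [hm]) (fun h => absurd hn h)]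
          simp
      _ = ∑ t ∈ k.support, ∑ m ∈ c.support, (k t * ((torusChar K m t : Kˣ) : K)) • c m := by
          rw [Finset.sum_comm]
          refine Finset.sum_congr rfl fun m hm => ?_
          rw [← Finset.sum_smul, ← hk m hm, Finsupp.sum]
      _ = _ := by
          rw [Finset.sum_smul]
          refine Finset.sum_congr rfl fun t _ => ?_
          rw [mul_smul, ← hf t, hc t, laurentEval, Finsupp.sum, Finset.smul_sum]
          simp only [smul_smul]
  have hne : (∑ t ∈ k.support, k t * f t) ≠ 0 := fun h => hcn (by rw [h1, h, zero_smul])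
  refine ⟨n, ?_⟩
  rw [← inv_smul_smul₀ hne a, ← h1]
  exact Submodule.smul_mem _ _ fun t => ρ.coeff_weight hc n t

/-- The inclusion is one of abstract groups, so `θ` is a mere choice of preimages. Characters
pulling back along `θ` to characters form a subgroup `H` containing every weight of a nonzero weight
vector; pairing with `v'` is additive on `H`. -/
theorem TorusAction.lieAlgebra_le_of_range_le (ρ : TorusAction K A r) (ρ' : TorusAction K A s)
    (h : ρ'.toHom.range ≤ ρ.toHom.range) {σ : Derivation K A A} (hσ : σ ∈ ρ'.lieAlgebra) :
    σ ∈ ρ.lieAlgebra := by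
  obtain ⟨v', hv'⟩ := hσ
  choose θ hθ using fun t => h ⟨t, rfl⟩
  let H : AddSubgroup (Fin r → ℤ) :=
    { carrier := {m | ∃ n : Fin s → ℤ, ∀ t, torusChar K m (θ t) = torusChar K n t}
      zero_mem' := ⟨0, fun t => by rw [torusChar_zero, torusChar_zero]⟩
      add_mem' := by
        rintro m m' ⟨n, hn⟩ ⟨n', hn'⟩
        exact ⟨n + n', fun t => by rw [torusChar_add, torusChar_add, hn, hn']⟩
      neg_mem' := by
        rintro m ⟨n, hn⟩
        exact ⟨-n, fun t => by rw [torusChar_neg, torusChar_neg, hn]⟩ }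
  choose η hη using fun m : H => m.2
  have huniq : ∀ (m : H) (n : Fin s → ℤ),
      (∀ t, torusChar K (m : Fin r → ℤ) (θ t) = torusChar K n t) → η m = n := fun m n hn =>
    torusChar_injective K s (MonoidHom.ext fun t => by rw [← hη, hn])
  let φ : H →+ K :=
    AddMonoidHom.mk' (fun m => ∑ i, (η m i : K) * v' i) fun m m' => by
      have : η (m + m') = η m + η m' := huniq _ _ fun t => by
        rw [AddSubgroup.coe_add, torusChar_add, torusChar_add, hη, hη]
      rw [this]
      simp [add_mul, Finset.sum_add_distrib]
  -- `K` is divisible, so `φ` extends from `H` to `ℤ^r`; its values on the standard basis are the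
  -- tangent vector sought.
  obtain ⟨ψ, hψ⟩ := (Module.Baer.of_divisible K).extension_property_addMonoidHom H.subtype
    H.subtype_injective φ
  refine ⟨fun i => ψ (Pi.single i 1), ρ.isDifferential_of_weight fun m a ha => ?_⟩
  have hψm : ∑ i, (m i : K) * ψ (Pi.single i 1) = ψ m := by
    conv_rhs => rw [pi_eq_sum_univ' m]
    rw [map_sum]
    exact Finset.sum_congr rfl fun i _ => by rw [map_zsmul, zsmul_eq_mul]
  rw [hψm]
  rcases eq_or_ne a 0 with rfl | ha0
  · simp
  have hact : ∀ t, ρ'.toHom t a = ((torusChar K m (θ t) : Kˣ) : K) • a := fun t => by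
    rw [← hθ t, ha]
  obtain ⟨n, hn⟩ := ρ'.exists_mem_weightSpace ha0 _ hact
  have hmn : ∀ t, torusChar K m (θ t) = torusChar K n t := fun t =>
    Units.ext (smul_left_injective K ha0 (by
      change _ • a = _ • a
      rw [← hact t, hn t]))
  have h1 : ψ m = ∑ i, (n i : K) * v' i := by
    have h2 : ψ m = φ ⟨m, n, hmn⟩ := DFunLike.congr_fun hψ (⟨m, n, hmn⟩ : H)
    rw [h2]
    change ∑ i, (η ⟨m, n, hmn⟩ i : K) * v' i = _
    rw [huniq _ n hmn]
  rw [h1]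
  exact hv'.apply_weight hn

end Subtorus

end AffineAut

theorem mainTheorem5 {K A : Type*} [Field K] [IsAlgClosed K] [CharZero K]
    [CommRing A] [Algebra K A] [Algebra.FiniteType K A] [IsReduced A]
    (hU : ∀ g ∈ AffineAut.unipotentGroup K A, ∀ h ∈ AffineAut.unipotentGroup K A, g * h = h * g)
    {r : ℕ} (ρ : AffineAut.TorusAction K A r) (hρ : Function.Injective ρ.toHom)
    (hmax : Maximal AffineAut.IsSubtorus ρ.toHom.range) :
    (∀ τ ∈ ρ.lieAlgebra, ∀ ν ∈ AffineAut.unipotentLieAlgebra K A,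
      ⁅τ, ν⁆ ∈ AffineAut.unipotentLieAlgebra K A) ∧
    (∀ δ ∈ ρ.lieAlgebra, δ ∈ AffineAut.unipotentLieAlgebra K A → δ = 0) ∧
    (∀ δ : Derivation K A A, AffineAut.IsLocallyFinite δ →
      ∃ τ ∈ ρ.lieAlgebra, ∃ ν ∈ AffineAut.unipotentLieAlgebra K A, δ = τ + ν) := by
  refine ⟨fun τ hτ ν hν => ρ.lie_mem_unipotentLieAlgebra hU hτ hν, fun δ hδ hδu =>
    ρ.eq_zero_of_mem_lieAlgebra_of_isLocallyNilpotent hδ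
      ((AffineAut.mem_unipotentLieAlgebra_iff hU).mp hδu), fun δ hδ => ?_⟩
  obtain ⟨ν, hν, hfin, hcomm⟩ := ρ.exists_sub_commutes hU hδ
  obtain ⟨s, ρ', hinj, hle, σ, hσ, hnil⟩ := ρ.exists_jordan hfin hcomm
  -- Maximality makes the larger torus equal to the given one, so `σ` is tangent to the latter.
  have hge := hmax.2 ⟨s, ρ', hinj, rfl⟩ hle
  refine ⟨σ, ρ.lieAlgebra_le_of_range_le ρ' hge hσ, (δ - ν - σ) + ν,
    add_mem ((AffineAut.mem_unipotentLieAlgebra_iff hU).mpr hnil)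
      ((AffineAut.mem_unipotentLieAlgebra_iff hU).mpr hν), ?_⟩
  abel
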